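/- Let $S_\infty$ be the group of permutations of $\mathbb N$ that move only finitely many elements, $G=S_\infty\times S_\infty$, and let $K=\{(\sigma,\sigma)\}\subset G$ be the diagonal subgroup. Let $H=\ell_2\otimes\ell_2$ be the real Hilbert space with orthonormal basis $e_i\otimes e_j$, $i,j\in\mathbb N$, and let $\widehat H\supset H$ be the space of all formal sums $\sum x_{ij}\,e_i\otimes e_j$. The group $G$ acts on $\widehat H$ by $U(\sigma,\tau)\,e_i\otimes e_j=e_{\sigma i}\otimes e_{\tau j}$. Fix $s>0$ and put $\eta=s\sum_j e_j\otimes e_j\in\widehat H$ and $\Xi(g)=U(g)\eta-\eta$. Let $\mathbf F$ be the boson Fock space with variables $z_{ij}$: the completion of the union, over the finite sets $S\subset\mathbb N\times\mathbb N$, of the spaces $F_S$ of entire functions on $\mathbb C^S$ with finite norm for the inner product $\langle f,g\rangle=\pi^{-|S|}\int_{\mathbb C^S} f(z)\overline{g(z)}\,e^{-\langle z,z\rangle}\,dz$, a function on $\mathbb C^S$ being regarded as a function of all the variables. Let $\mathrm{Isom}(H)=\mathrm O(H)\ltimes H$ be the group of affine isometries of $H$. Then the following hold. 1. $\eta\notin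 H$, but $\Xi(g)\in H$ for all $g\in G$; moreover $\Xi(g_1g_2)=U(g_1)\Xi(g_2)+\Xi(g_1)$ for all $g_1,g_2\in G$, and $\Xi(k)=0$ for all $k\in K$. The formula $\widetilde U(g)h=U(g)h+\Xi(g)$ defines an affine isometric action of $G$ on $H$, i.e. a homomorphism $\widetilde U:G\to\mathrm{Isom}(H)$. 2. For each point $z$ of the complexification $H_{\mathbb C}$ the evaluation $f\mapsto f(z)$ extends continuously from $\bigcup_S F_S$ to $\mathbf F$, and an element of $\mathbf F$ is determined by its values on $H_{\mathbb C}$. There is exactly one homomorphism $Exp$ from $\mathrm{Isom}(H)$ to the unitary group of $\mathbf F$ such that $$Exp(A)f(z)=f(zA)\quad(A\in\mathrm O(H)),\qquad Exp(v)f(z)=f(z+v)\,e^{-\langle z,v\rangle-\frac12\langle v,v\rangle}\quad(v\in H),$$ where $z$ is a row, so that $zA=A^{-1}z$, and $\langle x+iy,v\rangle=\langle x,v\rangle+i\langle y,v\rangle$ for $x,y,v\in H$. 3. For the unitary representation $\rho(g)=Exp(\widetilde U(g))$ of $G$ in $\mathbf F$, the unit vector $1$ is the unique $K$-fixed vector up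 to scalar factors: a vector $f\in\mathbf F$ satisfies $\rho(k)f=f$ for all $k\in K$ if and only if $f\in\mathbb C\cdot 1$. 4. With $\alpha=e^{-s^2}$ the spherical function is $$\langle\rho(\sigma,\tau)1,1\rangle=\alpha^{\#\{i:\ \sigma i\ne\tau i\}}=\prod_{k\ge2}\left(\alpha^k\right)^{\text{number of cycles of }\sigma\tau^{-1}\text{ of length }k},$$ which is Thoma's function $$\Phi_{\alpha,\beta}(\sigma,\tau)=\prod_{k\ge2}\Bigl(\sum_i\alpha_i^k+(-1)^{k-1}\sum_j\beta_j^k\Bigr)^{\text{number of cycles of }\sigma\tau^{-1}\text{ of length }k}$$ for the one-element collection $\{\alpha\}$ and the empty collection $\beta$. The subrepresentation of $\rho$ in the closed linear span of $\{\rho(g)1: g\in G\}$ is irreducible; it is thus the Thoma representation with these parameters. -/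

import Mathlib

open MeasureTheory

namespace ThomaFock

noncomputable section

/-! ### The boson Fock space -/

/-- The Gaussian measure `π⁻¹ exp (-|z|²) dz` on `ℂ`. -/
def gaussC : Measure ℂ :=
  volume.withDensity fun z => ENNReal.ofReal (Real.pi⁻¹ * Real.exp (-‖z‖ ^ 2))

theorem integral_exp_neg_normSq : ∫ z : ℂ, Real.exp (-‖z‖ ^ 2) = Real.pi := by
  have h := GaussianFourier.integral_rexp_neg_mul_sq_norm (V := ℂ) (b := 1) one_pos
  simpa using h

theorem integrable_gaussC_density :
    Integrable (fun z : ℂ => Real.pi⁻¹ * Real.exp (-‖z‖ ^ 2)) := by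
  refine Integrable.const_mul ?_ _
  by_contra h
  have := integral_undef h
  rw [integral_exp_neg_normSq] at this
  exact Real.pi_ne_zero this

instance gaussC_isProbabilityMeasure : IsProbabilityMeasure gaussC := by
  constructor
  rw [gaussC, withDensity_apply _ MeasurableSet.univ, Measure.restrict_univ,
    ← ofReal_integral_eq_lintegral_ofReal integrable_gaussC_density
      (Filter.Eventually.of_forall fun z => by positivity),
    integral_const_mul, integral_exp_neg_normSq, inv_mul_cancel₀ Real.pi_ne_zero,
    ENNReal.ofReal_one]

instance gaussC_isOpenPosMeasure : gaussC.IsOpenPosMeasure := by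
  have h : (volume : Measure ℂ) ≪ gaussC := by
    refine withDensity_absolutelyContinuous' (by fun_prop) ?_
    refine Filter.Eventually.of_forall fun z => ?_
    have : 0 < Real.pi⁻¹ * Real.exp (-‖z‖ ^ 2) := by positivity
    simpa using this
  exact h.isOpenPosMeasure

/-- The product of the measures `π⁻¹ exp (-|z|²) dz` over all the coordinates. -/
abbrev gaussPi (ι : Type) : Measure (ι → ℂ) := Measure.infinitePi fun _ => gaussC

/-- The finite-dimensional marginal of `gaussPi` is `π⁻ⁿ exp (-∑ |zᵢ|²) dz`. -/
theorem pi_gaussC (κ : Type) [Fintype κ] :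
    Measure.pi (fun _ : κ => gaussC) = (volume : Measure (κ → ℂ)).withDensity fun z =>
      ENNReal.ofReal ((Real.pi ^ Fintype.card κ)⁻¹ * Real.exp (-∑ i, ‖z i‖ ^ 2)) := by
  refine Measure.pi_eq fun t ht => ?_
  have key : ∀ z : κ → ℂ, (Real.pi ^ Fintype.card κ)⁻¹ * Real.exp (-∑ i, ‖z i‖ ^ 2) =
      ∏ i, (Real.pi⁻¹ * Real.exp (-‖z i‖ ^ 2)) := by
    intro z
    rw [Finset.prod_mul_distrib, ← Real.exp_sum, Finset.sum_neg_distrib, Finset.prod_const,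
      Finset.card_univ, inv_pow]
  simp_rw [key]
  rw [withDensity_apply _ (MeasurableSet.univ_pi ht), volume_pi, Measure.restrict_pi_pi,
    ← ofReal_integral_eq_lintegral_ofReal]
  · rw [integral_fintype_prod_eq_prod (fun _ (w : ℂ) => Real.pi⁻¹ * Real.exp (-‖w‖ ^ 2)),
      ENNReal.ofReal_prod_of_nonneg]
    · refine Finset.prod_congr rfl fun i _ => ?_
      rw [gaussC, withDensity_apply _ (ht i), ofReal_integral_eq_lintegral_ofReal]
      · exact integrable_gaussC_density.restrict
      · exact Filter.Eventually.of_forall fun z => by positivity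
    · exact fun i _ => integral_nonneg fun z => by positivity
  · exact Integrable.fintype_prod fun i => integrable_gaussC_density.restrict
  · exact Filter.Eventually.of_forall fun z => Finset.prod_nonneg fun i _ => by positivity

/-- The union of the spaces `F_S` over the finite sets `S` of coordinates, where `F_S` consists of
the entire functions of the coordinates in `S` that are square integrable with respect to
`π^(-|S|) exp (-|z|²) dz`; a function of the coordinates in `S` is regarded as a function of all
the coordinates. -/
def preFockSubmodule (ι : Type) : Submodule ℂ ((ι → ℂ) → ℂ) where
  carrier := {f | (∃ (S : Finset ι) (g : (S → ℂ) → ℂ), Differentiable ℂ g ∧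
    ∀ z, f z = g (S.restrict z)) ∧ MemLp f 2 (gaussPi ι)}
  zero_mem' := ⟨⟨∅, fun _ => 0, by fun_prop, fun _ => rfl⟩, MemLp.zero⟩
  add_mem' := by
    classical
    rintro f f' ⟨⟨S, g, hg, hf⟩, h⟩ ⟨⟨S', g', hg', hf'⟩, h'⟩
    refine ⟨⟨S ∪ S', fun z => g (fun i => z ⟨i, Finset.mem_union_left _ i.2⟩) +
      g' (fun i => z ⟨i, Finset.mem_union_right _ i.2⟩), by fun_prop, fun z => ?_⟩, h.add h'⟩
    rw [Pi.add_apply, hf, hf']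
    rfl
  smul_mem' := by
    rintro c f ⟨⟨S, g, hg, hf⟩, h⟩
    refine ⟨⟨S, fun z => c * g z, by fun_prop, fun z => ?_⟩, h.const_smul c⟩
    rw [Pi.smul_apply, hf, smul_eq_mul]

/-- The same space as a type of its own, so that it does not carry the topology of pointwise
convergence. -/
def PreFock (ι : Type) : Type := preFockSubmodule ι

instance (ι : Type) : AddCommGroup (PreFock ι) := inferInstanceAs (AddCommGroup (preFockSubmodule ι))

instance (ι : Type) : Module ℂ (PreFock ι) := inferInstanceAs (Module ℂ (preFockSubmodule ι))

theorem PreFock.memLp {ι : Type} (f : PreFock ι) : MemLp f.1 2 (gaussPi ι) := f.2.2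

theorem PreFock.integrable {ι : Type} (f g : PreFock ι) :
    Integrable (fun z => starRingEnd ℂ (f.1 z) * g.1 z) (gaussPi ι) :=
  f.memLp.star.integrable_mul g.memLp

/-- The Hermitian form `⟨f, g⟩ = ∫ conj f * g`, antilinear in the first variable. -/
@[reducible]
def preFockCore (ι : Type) : InnerProductSpace.Core ℂ (PreFock ι) where
  inner f g := ∫ z, starRingEnd ℂ (f.1 z) * g.1 z ∂(gaussPi ι)
  conj_inner_symm f g := by
    rw [← integral_conj]
    simp [mul_comm]
  re_inner_nonneg f := by
    have h : ∀ z, starRingEnd ℂ (f.1 z) * f.1 z = ((‖f.1 z‖ ^ 2 : ℝ) : ℂ) := by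
      intro z
      rw [mul_comm, Complex.mul_conj, Complex.normSq_eq_norm_sq]
    simp_rw [h]
    change 0 ≤ (∫ z, ((‖f.1 z‖ ^ 2 : ℝ) : ℂ) ∂(gaussPi ι)).re
    rw [integral_complex_ofReal, Complex.ofReal_re]
    exact integral_nonneg fun z => by positivity
  add_left f g k := by
    rw [← integral_add (f.integrable k) (g.integrable k)]
    refine integral_congr_ae (Filter.Eventually.of_forall fun z => ?_)
    change starRingEnd ℂ (f.1 z + g.1 z) * k.1 z = _
    rw [map_add, add_mul]
  smul_left f g r := by
    rw [← integral_const_mul]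
    refine integral_congr_ae (Filter.Eventually.of_forall fun z => ?_)
    change starRingEnd ℂ (r * f.1 z) * g.1 z = _
    rw [map_mul, mul_assoc]
  definite f hf := by
    have h : ∀ z, starRingEnd ℂ (f.1 z) * f.1 z = ((‖f.1 z‖ ^ 2 : ℝ) : ℂ) := by
      intro z
      rw [mul_comm, Complex.mul_conj, Complex.normSq_eq_norm_sq]
    have hi := f.integrable f
    simp_rw [h] at hf hi
    rw [integral_complex_ofReal, Complex.ofReal_eq_zero, integral_eq_zero_iff_of_nonneg
      (fun z => by positivity) (by simpa only [RCLike.re_eq_complex_re, Complex.ofReal_re] using hi.re)] at hf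
    obtain ⟨⟨S, g, hg, hfg⟩, -⟩ := f.2
    have hae : ∀ᵐ z ∂(gaussPi ι), g (S.restrict z) = 0 := by
      filter_upwards [hf] with z hz
      rw [← hfg]
      simpa using hz
    have hae' : g =ᵐ[Measure.pi fun _ : S => gaussC] fun _ => 0 := by
      rw [← Measure.infinitePi_map_restrict (fun _ : ι => gaussC)]
      have hm : MeasurableSet {w | g w = 0} :=
        measurableSet_eq_fun hg.continuous.measurable measurable_const
      exact (ae_map_iff (Finset.measurable_restrict S).aemeasurable hm).2 hae
    have h0 := Continuous.ae_eq_iff_eq _ hg.continuous continuous_const |>.1 hae'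
    refine Subtype.ext (funext fun z => ?_)
    rw [hfg, h0]
    rfl

instance (ι : Type) : NormedAddCommGroup (PreFock ι) := (preFockCore ι).toNormedAddCommGroup

instance (ι : Type) : InnerProductSpace ℂ (PreFock ι) := InnerProductSpace.ofCore (preFockCore ι).1

/-- On functions of the coordinates in a finite set `S` the inner product is
`π^(-|S|) ∫ conj f * g * exp (-|z|²) dz`. -/
theorem preFock_inner {ι : Type} (S : Finset ι) (f g : PreFock ι) (f' g' : (S → ℂ) → ℂ)
    (hf' : Differentiable ℂ f') (hg' : Differentiable ℂ g')
    (hf : ∀ z, f.1 z = f' (S.restrict z)) (hg : ∀ z, g.1 z = g' (S.restrict z)) :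
    inner ℂ f g = ((Real.pi ^ S.card)⁻¹ : ℝ) * ∫ z : S → ℂ,
      starRingEnd ℂ (f' z) * g' z * (Real.exp (-∑ i, ‖z i‖ ^ 2) : ℝ) := by
  change ∫ z, starRingEnd ℂ (f.1 z) * g.1 z ∂(gaussPi ι) = _
  simp_rw [hf, hg]
  have hc : Continuous fun z => starRingEnd ℂ (f' z) * g' z :=
    (Complex.continuous_conj.comp hf'.continuous).mul hg'.continuous
  rw [integral_restrict_infinitePi (fun _ : ι => gaussC)
    (f := fun z => starRingEnd ℂ (f' z) * g' z) hc.aestronglyMeasurable, pi_gaussC,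
    integral_withDensity_eq_integral_toReal_smul (by fun_prop) (by simp),
    ← integral_const_mul]
  congr 1
  ext z
  rw [ENNReal.toReal_ofReal (by positivity), Complex.real_smul, Fintype.card_coe]
  push_cast
  ring

/-- The boson Fock space with variables indexed by `ι`: the completion of the union of the spaces
of entire functions of finitely many of the variables. -/
abbrev Fock (ι : Type) : Type := UniformSpace.Completion (PreFock ι)

/-- The real Hilbert space `ℓ₂(ι)`. -/
abbrev L2 (ι : Type) : Type := lp (fun _ : ι => ℝ) 2

/-- The point `z = x + iy` of the complexification of `ℓ₂(ι)`. -/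
def cpoint {ι : Type} (x y : L2 ι) : ι → ℂ := fun i => (x i : ℂ) + (y i : ℂ) * Complex.I

/-- The value of an element of the Fock space at the point `x + iy` of the complexified `ℓ₂(ι)`:
the extension by continuity of the value of a function of finitely many variables. -/
def Fock.eval {ι : Type} (f : Fock ι) (x y : L2 ι) : ℂ :=
  UniformSpace.Completion.extension (fun p : PreFock ι => p.1 (cpoint x y)) f

/-- The constant function `1` as a function of finitely many variables. -/
def PreFock.one (ι : Type) : PreFock ι :=
  ⟨fun _ => 1, ⟨∅, fun _ => 1, by fun_prop, fun _ => rfl⟩, memLp_const 1⟩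

/-- The constant function `1`. -/
def Fock.one (ι : Type) : Fock ι := (PreFock.one ι : Fock ι)

/-- `E` is the representation `Exp` of the group of affine isometries of `ℓ₂(ι)` by unitary
operators of the Fock space: an orthogonal operator `A` acts by `f(z) ↦ f(zA)`, where `z` is a row,
that is, `zA = Aᵀz = A⁻¹z`, and the translation by `v` acts by
`f(z) ↦ f(z + v) exp (-⟨z, v⟩ - ⟨v, v⟩ / 2)`, where `⟨x + iy, v⟩ = ⟨x, v⟩ + i ⟨y, v⟩`. -/
structure IsExp {ι : Type} (E : (L2 ι ≃ᵃⁱ[ℝ] L2 ι) →* (Fock ι ≃ₗᵢ[ℂ] Fock ι)) : Prop where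
  orthogonal (A : L2 ι ≃ₗᵢ[ℝ] L2 ι) (f : Fock ι) (x y : L2 ι) :
    Fock.eval (E A.toAffineIsometryEquiv f) x y = Fock.eval f (A.symm x) (A.symm y)
  translation (v : L2 ι) (f : Fock ι) (x y : L2 ι) :
    Fock.eval (E (AffineIsometryEquiv.constVAdd ℝ (L2 ι) v) f) x y =
      Fock.eval f (x + v) y * Complex.exp
        (-(((inner ℝ x v : ℝ) : ℂ) + ((inner ℝ y v : ℝ) : ℂ) * Complex.I) -
          ((inner ℝ v v : ℝ) : ℂ) / 2)

/-! ### The double of the infinite symmetric group -/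

/-- The group `S_∞` of finite permutations of `ℕ`. -/
def SInf : Subgroup (Equiv.Perm ℕ) where
  carrier := {σ | {i | σ i ≠ i}.Finite}
  one_mem' := by simp
  mul_mem' := by
    intro σ τ hσ hτ
    refine (hσ.union hτ).subset fun i hi => ?_
    by_contra h
    simp only [Set.mem_union, Set.mem_ofPred_eq, not_or, not_not] at h
    exact hi (by rw [Equiv.Perm.mul_apply, h.2, h.1])
  inv_mem' := by
    intro σ hσ
    refine Set.Finite.subset hσ fun i hi h => hi ?_
    rw [Equiv.Perm.inv_eq_iff_eq, h]

/-- The group `G = S_∞ × S_∞`. -/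
abbrev GG : Type := SInf × SInf

/-- The diagonal subgroup `K` of `G`. -/
def KK : Subgroup GG := ((MonoidHom.id SInf).prod (MonoidHom.id SInf)).range

/-- The representation of `G` in the space of all formal sums `∑ xᵢⱼ eᵢ ⊗ eⱼ`, which contains
`ℓ₂ ⊗ ℓ₂ = ℓ₂(ℕ × ℕ)`; it is given by `eᵢ ⊗ eⱼ ↦ e_{σ i} ⊗ e_{τ j}`. -/
def UU : Representation ℝ GG (ℕ × ℕ → ℝ) where
  toFun g :=
    { toFun := fun x p => x ((g.1 : Equiv.Perm ℕ).symm p.1, (g.2 : Equiv.Perm ℕ).symm p.2)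
      map_add' := fun _ _ => rfl
      map_smul' := fun _ _ => rfl }
  map_one' := rfl
  map_mul' _ _ := rfl

theorem UU_single (g : GG) (i j : ℕ) :
    UU g (Pi.single (i, j) 1) =
      Pi.single ((g.1 : Equiv.Perm ℕ) i, (g.2 : Equiv.Perm ℕ) j) 1 := by
  ext ⟨k, l⟩
  change (Pi.single (i, j) 1 : ℕ × ℕ → ℝ) ((g.1 : Equiv.Perm ℕ).symm k,
    (g.2 : Equiv.Perm ℕ).symm l) = _
  simp [Pi.single_apply, Equiv.symm_apply_eq]

/-- The formal sum `η = s ∑ⱼ eⱼ ⊗ eⱼ`. -/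
def eta (s : ℝ) : ℕ × ℕ → ℝ := fun p => if p.1 = p.2 then s else 0

/-- `Ξ(g) = U(g) η - η`. -/
def Xi (s : ℝ) (g : GG) : ℕ × ℕ → ℝ := UU g (eta s) - eta s

/-- The number of cycles of length `k` of a permutation of `ℕ`. -/
def numCycles (π : Equiv.Perm ℕ) (k : ℕ) : ℕ :=
  {C : Set ℕ | (∃ i, C = {j | π.SameCycle i j}) ∧ C.ncard = k}.ncard

/-- Thoma's function `Φ_{α,β}(σ, τ)`, the product over `k ≥ 2` of the factors
`(∑ αᵢᵏ + (-1)ᵏ⁻¹ ∑ βⱼᵏ) ^ (number of cycles of length k of σ τ⁻¹)`. -/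
def thoma {I J : Type} (α : I → ℝ) (β : J → ℝ) (g : GG) : ℝ :=
  ∏ᶠ (k : ℕ) (_ : 2 ≤ k), ((∑' i, α i ^ k) + (-1) ^ (k - 1) * ∑' j, β j ^ k) ^
    numCycles ((g.1 : Equiv.Perm ℕ) * (g.2 : Equiv.Perm ℕ)⁻¹) k

end

end ThomaFock

open MeasureTheory

namespace ThomaFock

noncomputable section

/-! ### Gaussian integrals of entire functions of finitely many variables. -/

section

/-! The Fock space is a reproducing kernel space: evaluation at `z` is the pairing with the coherent
state `exp ⟨·, z⟩`, and the Gram matrix of these vectors is `exp ⟨z, w⟩` (`Fock.inner_ker_ker`). In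
finitely many variables this follows by completing the square in the Gaussian and applying the mean
value property of entire functions (`integral_conj_cexp_mul`). The resulting bound `|f(z)| ≤ exp
(|z|² / 2) ‖f‖` does not depend on the number of variables, so evaluation extends to the
complexified `ℓ₂`. Coherent states are total (`PreFock.mem_closure_span_ker`), so an element is
determined by its values.

For an affine isometry with linear part `A` and translation part `v`, the adjoint of the operator
sought must send coherent states to explicit multiples of coherent states. The Gram matrix is
unchanged, so a unitary operator exists (`exists_expOperator`). Since `v` is real, the multipliers
compose without a phase, and the operators form a genuine representation.

The group `K` permutes rows and columns simultaneously. A `K`-invariant `f` is close to a function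
of finitely many variables, and an element of `K` moves a finitely supported point off those
variables; hence `f(z) = f(0)` (`eval_eq_of_invariant`). The spherical function is `exp (-‖Ξ(g)‖² /
2)`, and `Ξ(g)` has one entry `s` and one entry `-s` for every `i` with `σ i ≠ τ i`. Sorting the
points moved by `σ τ⁻¹` into cycles gives Thoma's product. Irreducibility is formal: the projection
of `1` to a closed invariant subspace is `K`-fixed, hence a multiple of `1`. -/

theorem measurePreserving_rotation_gaussC (c : Circle) :
    MeasurePreserving (fun z : ℂ => (c : ℂ) * z) gaussC gaussC := by
  have h : MeasurePreserving (rotation c) volume volume := (rotation c).measurePreserving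
  refine ⟨by fun_prop, ?_⟩
  ext s hs
  rw [Measure.map_apply (by fun_prop) hs, gaussC, withDensity_apply _ hs,
    withDensity_apply _ ((measurable_const_mul _) hs)]
  have := h.setLIntegral_comp_preimage hs
    (f := fun z => ENNReal.ofReal (Real.pi⁻¹ * Real.exp (-‖z‖ ^ 2))) (by fun_prop)
  simp only [LinearIsometryEquiv.norm_map] at this
  exact this

variable {κ : Type} [Fintype κ]

/-- The Gaussian measure on `ℂ^κ` is invariant under the scalar action of the circle. -/
theorem measurePreserving_circle_smul (c : Circle) :
    MeasurePreserving (fun z : κ → ℂ => (c : ℂ) • z)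
      (Measure.pi fun _ => gaussC) (Measure.pi fun _ => gaussC) :=
  measurePreserving_pi _ _ fun _ => measurePreserving_rotation_gaussC c

/-- This is the one-variable mean value property of `t ↦ f (t z)` on the unit circle. -/
theorem integral_circleMap_smul {f : (κ → ℂ) → ℂ} (hf : Differentiable ℂ f) (z : κ → ℂ) :
    ∫ θ in (0)..(2 * Real.pi), f (circleMap 0 1 θ • z) = (2 * Real.pi : ℝ) • f 0 := by
  have h : DiffContOnCl ℂ (fun t : ℂ => f (t • z)) (Metric.ball 0 |1|) :=
    Differentiable.diffContOnCl (by fun_prop)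
  have := h.circleAverage
  rw [Real.circleAverage_def, zero_smul] at this
  rw [← this, smul_smul, mul_inv_cancel₀ (by positivity), one_smul]

/-- The mean value property of entire functions with respect to the Gaussian measure. -/
theorem integral_pi_gaussC_of_differentiable {f : (κ → ℂ) → ℂ} (hf : Differentiable ℂ f)
    (hi : Integrable f (Measure.pi fun _ => gaussC)) :
    ∫ z, f z ∂(Measure.pi fun _ => gaussC) = f 0 := by
  set γ : Measure (κ → ℂ) := Measure.pi fun _ => gaussC
  have hmp (θ : ℝ) : MeasurePreserving (fun z : κ → ℂ => circleMap 0 1 θ • z) γ γ := by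
    convert measurePreserving_circle_smul (κ := κ) (Circle.exp θ) using 2
    simp [circleMap]
  have hemb (θ : ℝ) : MeasurableEmbedding (fun z : κ → ℂ => circleMap 0 1 θ • z) :=
    (Homeomorph.smulOfNeZero (circleMap 0 1 θ)
      (circleMap_ne_center one_ne_zero)).measurableEmbedding
  have hc : Continuous fun q : ℝ × (κ → ℂ) => f (circleMap 0 1 q.1 • q.2) :=
    hf.continuous.comp (((continuous_circleMap 0 1).comp continuous_fst).smul continuous_snd)
  -- Fubini applies because, by rotation invariance, the `L¹` norm of the inner function is the same
  -- for every angle.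
  have hprod : Integrable (Function.uncurry fun (θ : ℝ) (z : κ → ℂ) => f (circleMap 0 1 θ • z))
      ((volume.restrict (Set.uIoc 0 (2 * Real.pi))).prod γ) := by
    refine (integrable_prod_iff hc.aestronglyMeasurable).2 ⟨Filter.Eventually.of_forall fun θ => (hmp θ).integrable_comp_of_integrable hi, ?_⟩
    have : ∀ θ : ℝ, ∫ z, ‖f (circleMap 0 1 θ • z)‖ ∂γ = ∫ z, ‖f z‖ ∂γ := fun θ =>
      (hmp θ).integral_comp (hemb θ) fun z => ‖f z‖
    simp only [this]
    exact integrableOn_const measure_Ioc_lt_top.ne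
  -- In one order the integral over the angle gives `2π f(0)` for each `z`; in the other, rotation
  -- invariance gives `2π ∫ f`.
  have h1 := intervalIntegral_integral_swap hprod
  simp only [integral_circleMap_smul hf, (hmp _).integral_comp (hemb _) f] at h1
  simp only [intervalIntegral.integral_const, integral_const, probReal_univ, one_smul,
    sub_zero] at h1
  exact (smul_right_injective ℂ (by positivity : (2 * Real.pi : ℝ) ≠ 0)) h1

theorem integrable_cexp_mul_gaussC (w : ℂ) :
    Integrable (fun z : ℂ => Complex.exp (z * w)) gaussC := by
  rw [gaussC, integrable_withDensity_iff_integrable_smul' (by fun_prop) (by simp)]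
  -- The conjugate appears because the real inner product of `conj w` and `z` is `Re (z w)`.
  have h := (GaussianFourier.integrable_cexp_neg_mul_sq_norm_add (V := ℂ) (b := 1) (by simp) 1
    (starRingEnd ℂ w)).norm.const_mul Real.pi⁻¹
  refine (integrable_norm_iff (by fun_prop)).1 (h.congr (Filter.Eventually.of_forall fun z => ?_))
  simp only [norm_smul, Complex.norm_exp]
  rw [ENNReal.toReal_ofReal (by positivity), Real.norm_of_nonneg (by positivity), mul_assoc,
    ← Real.exp_add]
  congr 2
  simp [← Complex.ofReal_pow, Complex.inner]

theorem integrable_cexp_sum_mul (w : κ → ℂ) :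
    Integrable (fun z : κ → ℂ => Complex.exp (∑ i, z i * w i)) (Measure.pi fun _ => gaussC) := by
  simp_rw [Complex.exp_sum]
  exact Integrable.fintype_prod (f := fun i z => Complex.exp (z * w i))
    fun i => integrable_cexp_mul_gaussC (w i)

theorem memLp_cexp_sum_mul (w : κ → ℂ) :
    MemLp (fun z : κ → ℂ => Complex.exp (∑ i, z i * w i)) 2 (Measure.pi fun _ => gaussC) := by
  have hc : Continuous fun z : κ → ℂ => Complex.exp (∑ i, z i * w i) := by fun_prop
  rw [memLp_two_iff_integrable_sq_norm hc.aestronglyMeasurable]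
  -- The squared modulus of the exponential is the modulus of the exponential with `w` doubled.
  refine (integrable_cexp_sum_mul fun i => 2 * w i).norm.congr
    (Filter.Eventually.of_forall fun z => ?_)
  simp only [← norm_pow, ← Complex.exp_nat_mul, Finset.mul_sum]
  congr 2
  exact Finset.sum_congr rfl fun i _ => by push_cast; ring

theorem integral_pi_gaussC (f : (κ → ℂ) → ℂ) :
    ∫ z, f z ∂(Measure.pi fun _ => gaussC) = ∫ z : κ → ℂ,
      ((Real.pi ^ Fintype.card κ)⁻¹ * Real.exp (-∑ i, ‖z i‖ ^ 2)) • f z := by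
  rw [pi_gaussC, integral_withDensity_eq_integral_toReal_smul (by fun_prop) (by simp)]
  congr 1
  ext z
  rw [ENNReal.toReal_ofReal (by positivity)]

theorem integrable_pi_gaussC_iff (f : (κ → ℂ) → ℂ) :
    Integrable f (Measure.pi fun _ => gaussC) ↔ Integrable fun z : κ → ℂ =>
      ((Real.pi ^ Fintype.card κ)⁻¹ * Real.exp (-∑ i, ‖z i‖ ^ 2)) • f z := by
  rw [pi_gaussC, integrable_withDensity_iff_integrable_smul' (by fun_prop) (by simp)]
  refine integrable_congr (Filter.Eventually.of_forall fun z => ?_)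
  simp only
  rw [ENNReal.toReal_ofReal (by positivity)]

/-- The function `exp (∑ zᵢ conj wᵢ)` is the reproducing kernel at `w`. -/
theorem integral_conj_cexp_mul {f : (κ → ℂ) → ℂ} (hf : Differentiable ℂ f)
    (h2 : MemLp f 2 (Measure.pi fun _ => gaussC)) (w : κ → ℂ) :
    ∫ z, starRingEnd ℂ (Complex.exp (∑ i, z i * starRingEnd ℂ (w i))) * f z
      ∂(Measure.pi fun _ => gaussC) = f w := by
  set F : (κ → ℂ) → ℂ :=
    fun z => starRingEnd ℂ (Complex.exp (∑ i, z i * starRingEnd ℂ (w i))) * f z with hF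
  set G : (κ → ℂ) → ℂ := fun u => Complex.exp (-∑ i, u i * starRingEnd ℂ (w i)) * f (u + w)
  have hFi : Integrable F (Measure.pi fun _ => gaussC) :=
    (memLp_cexp_sum_mul fun i => starRingEnd ℂ (w i)).star.integrable_mul h2
  -- Translation by `w` completes the square: the antiholomorphic factor of the kernel cancels
  -- against the Gaussian, leaving the entire function `G`, and `G 0 = f w`.
  have key : ∀ u : κ → ℂ,
      ((Real.pi ^ Fintype.card κ)⁻¹ * Real.exp (-∑ i, ‖(u + w) i‖ ^ 2)) • F (u + w) =
      ((Real.pi ^ Fintype.card κ)⁻¹ * Real.exp (-∑ i, ‖u i‖ ^ 2)) • G u := by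
    intro u
    simp only [hF, G, mul_smul, Complex.real_smul, ← Complex.exp_conj]
    congr 1
    rw [← mul_assoc, ← mul_assoc]
    congr 1
    rw [Complex.ofReal_exp, Complex.ofReal_exp, ← Complex.exp_add, ← Complex.exp_add]
    congr 1
    push_cast
    simp only [← Complex.mul_conj', map_sum, map_mul, Complex.conj_conj,
      ← Finset.sum_neg_distrib, ← Finset.sum_add_distrib, Pi.add_apply, map_add]
    exact Finset.sum_congr rfl fun i _ => by ring
  have hGi : Integrable G (Measure.pi fun _ => gaussC) := by
    rw [integrable_pi_gaussC_iff] at hFi ⊢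
    simpa only [key] using hFi.comp_add_right w
  have hGd : Differentiable ℂ G := by fun_prop
  rw [integral_pi_gaussC, ← integral_add_right_eq_self (fun z : κ → ℂ =>
    ((Real.pi ^ Fintype.card κ)⁻¹ * Real.exp (-∑ i, ‖z i‖ ^ 2)) • F z) w,
    integral_congr_ae (Filter.Eventually.of_forall key), ← integral_pi_gaussC, integral_pi_gaussC_of_differentiable hGd hGi]
  simp [G]

end

/-! ### Coherent states among the functions of finitely many variables. -/

section

variable {ι : Type}

theorem memLp_comp_restrict_iff (S : Finset ι) {g : (S → ℂ) → ℂ} (hg : Continuous g) :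
    MemLp (fun z => g (S.restrict z)) 2 (gaussPi ι) ↔
      MemLp g 2 (Measure.pi fun _ : S => gaussC) := by
  rw [← Measure.infinitePi_map_restrict (fun _ : ι => gaussC),
    memLp_map_measure_iff hg.aestronglyMeasurable (Finset.measurable_restrict S).aemeasurable]
  rfl

/-- The coordinates outside of `S` replaced by zero. -/
def trunc (S : Finset ι) (w : ι → ℂ) : ι → ℂ := by
  classical exact fun i => if i ∈ S then w i else 0

theorem trunc_of_mem {S : Finset ι} {i : ι} (hi : i ∈ S) (w : ι → ℂ) : trunc S w i = w i := by
  simp [trunc, hi]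

theorem trunc_of_notMem {S : Finset ι} {i : ι} (hi : i ∉ S) (w : ι → ℂ) : trunc S w i = 0 := by
  simp [trunc, hi]

/-- The coherent state `exp (∑ zᵢ conj wᵢ)`, the sum being over `i ∈ S`. -/
def PreFock.ker (S : Finset ι) (w : ι → ℂ) : PreFock ι :=
  ⟨fun z => Complex.exp (∑ i ∈ S, z i * starRingEnd ℂ (w i)),
    ⟨S, fun z => Complex.exp (∑ i, z i * starRingEnd ℂ (w i)), by fun_prop, fun z =>
      congrArg Complex.exp (Finset.sum_coe_sort S fun i => z i * starRingEnd ℂ (w i)).symm⟩, by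
    have h := (memLp_comp_restrict_iff S
      (g := fun z => Complex.exp (∑ i : S, z i * starRingEnd ℂ (w i))) (by fun_prop)).2
      (memLp_cexp_sum_mul fun i : S => starRingEnd ℂ (w i))
    convert h using 3 with z
    exact (Finset.sum_coe_sort S fun i => z i * starRingEnd ℂ (w i)).symm⟩

theorem PreFock.ker_apply (S : Finset ι) (w z : ι → ℂ) :
    (PreFock.ker S w).1 z = Complex.exp (∑ i ∈ S, z i * starRingEnd ℂ (w i)) := rfl

theorem PreFock.inner_def (f g : PreFock ι) :
    inner ℂ f g = ∫ z, starRingEnd ℂ (f.1 z) * g.1 z ∂(gaussPi ι) := rfl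

/-- A function of finitely many variables takes equal values at points that agree on a suitable
finite set of coordinates. -/
theorem PreFock.exists_finset (p : PreFock ι) :
    ∃ S : Finset ι, ∀ z z' : ι → ℂ, (∀ i ∈ S, z i = z' i) → p.1 z = p.1 z' := by
  obtain ⟨⟨S, g, -, h⟩, -⟩ := p.2
  refine ⟨S, fun z z' hz => ?_⟩
  rw [h, h]
  congr 1
  ext i
  exact hz i i.2

/-- Over a finite set containing `S` and the variables of `p`, the coherent state is the reproducing
kernel at the truncated point, since coordinates outside `S` do not enter its exponent. -/
theorem PreFock.inner_ker (S : Finset ι) (w : ι → ℂ) (p : PreFock ι) :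
    inner ℂ (PreFock.ker S w) p = p.1 (trunc S w) := by
  classical
  obtain ⟨⟨T, g, hg, hp⟩, h2⟩ := p.2
  set R := S ∪ T
  set g' : (R → ℂ) → ℂ := fun z => g fun i => z ⟨i, Finset.mem_union_right _ i.2⟩
  have hg' : Differentiable ℂ g' := by fun_prop
  have hp' : ∀ z, p.1 z = g' (R.restrict z) := fun z => hp z
  have hm : MemLp g' 2 (Measure.pi fun _ : R => gaussC) := by
    rw [← memLp_comp_restrict_iff R hg'.continuous]
    simpa only [← hp'] using h2
  have hk : ∀ z : ι → ℂ, (PreFock.ker S w).1 z =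
      Complex.exp (∑ i : R, R.restrict z i * starRingEnd ℂ (R.restrict (trunc S w) i)) := by
    intro z
    rw [PreFock.ker_apply]
    congr 1
    change _ = ∑ i : R, z i * starRingEnd ℂ (trunc S w i)
    rw [Finset.sum_coe_sort R fun i => z i * starRingEnd ℂ (trunc S w i),
      ← Finset.sum_subset (Finset.subset_union_left : S ⊆ R)]
    · exact Finset.sum_congr rfl fun i hi => by rw [trunc_of_mem hi]
    · exact fun i _ hi => by rw [trunc_of_notMem hi]; simp
  rw [PreFock.inner_def]
  simp only [hk, hp']
  have hc : Continuous fun z : R → ℂ => starRingEnd ℂ (Complex.exp (∑ i : R, z i *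
      starRingEnd ℂ (R.restrict (trunc S w) i))) * g' z :=
    (Complex.continuous_conj.comp (by fun_prop)).mul hg'.continuous
  rw [integral_restrict_infinitePi (fun _ : ι => gaussC) (f := fun z : R → ℂ =>
    starRingEnd ℂ (Complex.exp (∑ i : R, z i *
      starRingEnd ℂ (R.restrict (trunc S w) i))) * g' z) hc.aestronglyMeasurable,
    integral_conj_cexp_mul hg' hm]

/-- The embedding of the functions of finitely many variables into `L²`. -/
def PreFock.toL2 : PreFock ι →ₗᵢ[ℂ] Lp ℂ 2 (gaussPi ι) :=
  LinearMap.isometryOfInner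
    { toFun := fun p => p.memLp.toLp p.1
      map_add' := fun p q => MemLp.toLp_add p.memLp q.memLp
      map_smul' := fun c p => MemLp.toLp_const_smul c p.memLp } fun p q => by
    rw [PreFock.inner_def, L2.inner_def]
    refine integral_congr_ae ?_
    filter_upwards [p.memLp.coeFn_toLp, q.memLp.coeFn_toLp] with z hp hq
    change inner ℂ (p.memLp.toLp p.1 z) (q.memLp.toLp q.1 z) = _
    rw [hp, hq, RCLike.inner_apply, mul_comm]

theorem PreFock.toL2_coeFn (p : PreFock ι) : PreFock.toL2 p =ᵐ[gaussPi ι] p.1 :=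
  p.memLp.coeFn_toLp

/-- The coherent states are total. -/
theorem PreFock.mem_closure_span_ker (p : PreFock ι) :
    p ∈ closure (Submodule.span ℂ
      (Set.range fun q : Finset ι × (ι → ℂ) => PreFock.ker q.1 q.2) : Set (PreFock ι)) := by
  classical
  obtain ⟨S, hS⟩ := p.exists_finset
  set N : Submodule ℂ (PreFock ι) := Submodule.span ℂ (Set.range (PreFock.ker S)) with hN
  have htr : ∀ z : ι → ℂ, ∀ i ∈ S, trunc S z i = z i := fun z i hi => trunc_of_mem hi z
  have hNe : ∀ b ∈ N, ∀ z, inner ℂ (PreFock.ker S z) b = b.1 z := by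
    intro b hb z
    induction hb using Submodule.span_induction with
    | mem b hb =>
      obtain ⟨w, rfl⟩ := hb
      rw [PreFock.inner_ker, PreFock.ker_apply, PreFock.ker_apply]
      congr 1
      exact Finset.sum_congr rfl fun i hi => by rw [trunc_of_mem hi]
    | zero => rw [inner_zero_right]; rfl
    | add a b _ _ ha hb => rw [inner_add_right, ha, hb]; rfl
    | smul c a _ ha => rw [inner_smul_right, ha]; rfl
  -- The projection is taken in `L²` because the space of functions of finitely many variables is
  -- not complete.
  set M : Submodule ℂ (Lp ℂ 2 (gaussPi ι)) :=
    (N.map PreFock.toL2.toLinearMap).topologicalClosure with hM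
  have : CompleteSpace M := (Submodule.isClosed_topologicalClosure _).completeSpace_coe
  set p₁ : Lp ℂ 2 (gaussPi ι) := M.starProjection (PreFock.toL2 p) with hp₁
  have hp₁M : p₁ ∈ M := Submodule.starProjection_apply_mem _ _
  obtain ⟨q, hqN, hq⟩ := mem_closure_iff_seq_limit.1
    (show p₁ ∈ closure (N.map PreFock.toL2.toLinearMap : Set _) from hp₁M)
  choose b hb hbq using hqN
  -- Since `p - p₁` is orthogonal to the kernels, pairing the approximants of `p₁` with a kernel
  -- shows that their values converge to those of `p`.
  have hpt : ∀ z, Filter.Tendsto (fun n => (b n).1 z) Filter.atTop (nhds (p.1 z)) := by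
    intro z
    have hkM : PreFock.toL2 (PreFock.ker S z) ∈ M :=
      Submodule.le_topologicalClosure _ ⟨_, Submodule.subset_span ⟨z, rfl⟩, rfl⟩
    have h1 : inner ℂ (PreFock.toL2 (PreFock.ker S z)) p₁ = p.1 z := by
      rw [hp₁, ← Submodule.inner_starProjection_left_eq_right,
        Submodule.starProjection_eq_self_iff.2 hkM, LinearIsometry.inner_map_map,
        PreFock.inner_ker]
      exact hS _ _ (htr z)
    have h2 : Filter.Tendsto (fun n => inner ℂ (PreFock.toL2 (PreFock.ker S z)) (q n))
        Filter.atTop (nhds (inner ℂ (PreFock.toL2 (PreFock.ker S z)) p₁)) :=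
      tendsto_const_nhds.inner hq
    rw [h1] at h2
    refine h2.congr fun n => ?_
    rw [← hbq, ← hNe _ (hb n)]
    exact LinearIsometry.inner_map_map _ _ _
  -- A subsequence of the approximants converges almost everywhere to `p₁`, while all values
  -- converge to those of `p`.
  have heq : p₁ = PreFock.toL2 p := by
    obtain ⟨φ, hφm, hφ⟩ := (tendstoInMeasure_of_tendsto_Lp hq).exists_seq_tendsto_ae
    have hφ' := ae_all_iff.2 fun n => PreFock.toL2_coeFn (b n)
    refine Lp.ext ?_
    filter_upwards [hφ, hφ', p.toL2_coeFn] with z h1 h2 h3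
    rw [h3]
    refine tendsto_nhds_unique h1 ?_
    refine ((hpt z).comp hφm.tendsto_atTop).congr fun n => ?_
    rw [← hbq, Function.comp_apply, ← h2 (φ n)]
    rfl
  rw [heq] at hp₁M
  have hcl : p ∈ closure (N : Set (PreFock ι)) := by
    rw [PreFock.toL2.isometry.isEmbedding.isInducing.closure_eq_preimage_closure_image]
    exact hp₁M
  refine closure_mono (Submodule.span_mono ?_) hcl
  rintro _ ⟨w, rfl⟩
  exact ⟨(S, w), rfl⟩

end

/-! ### Point evaluations, reproducing kernels and totality in the Fock space. -/

section

variable {ι : Type}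

/-- The sesquilinear form `∑ zᵢ conj z'ᵢ` on the complexified `ℓ₂(ι)`, where `z = x + iy` and
`z' = x' + iy'`. -/
def cinner (x y x' y' : L2 ι) : ℂ :=
  ((inner ℝ x x' : ℝ) : ℂ) + ((inner ℝ y y' : ℝ) : ℂ) +
    (((inner ℝ y x' : ℝ) : ℂ) - ((inner ℝ x y' : ℝ) : ℂ)) * Complex.I

theorem hasSum_cinner (x y x' y' : L2 ι) :
    HasSum (fun i => cpoint x y i * starRingEnd ℂ (cpoint x' y' i)) (cinner x y x' y') := by
  have h (a b : L2 ι) : HasSum (fun i => ((a i : ℂ) * (b i : ℂ))) ((inner ℝ a b : ℝ) : ℂ) := by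
    rw [real_inner_comm]
    have := Complex.hasSum_ofReal.2 (lp.hasSum_inner (𝕜 := ℝ) b a)
    simpa using this
  refine (((h x x').add (h y y')).add
    (((h y x').sub (h x y')).mul_right Complex.I)).congr_fun fun i => ?_
  simp only [cpoint, map_add, map_mul, Complex.conj_ofReal, Complex.conj_I]
  linear_combination (-(y i * y' i) : ℂ) * (Complex.I_mul_I)

theorem cinner_self (x y : L2 ι) : cinner x y x y = ((‖x‖ ^ 2 + ‖y‖ ^ 2 : ℝ) : ℂ) := by
  simp [cinner, real_inner_comm]

theorem sum_cpoint_mul_conj (S : Finset ι) (x y : L2 ι) :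
    ∑ i ∈ S, cpoint x y i * starRingEnd ℂ (cpoint x y i) =
      ((∑ i ∈ S, ‖cpoint x y i‖ ^ 2 : ℝ) : ℂ) := by
  push_cast
  exact Finset.sum_congr rfl fun i _ => Complex.mul_conj' _

theorem hasSum_norm_cpoint_sq (x y : L2 ι) :
    HasSum (fun i => ‖cpoint x y i‖ ^ 2) (‖x‖ ^ 2 + ‖y‖ ^ 2) := by
  have h := hasSum_cinner x y x y
  rw [cinner_self] at h
  refine Complex.hasSum_ofReal.1 (h.congr_fun fun i => ?_)
  rw [Complex.mul_conj']
  push_cast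
  rfl

theorem PreFock.norm_ker_sq (S : Finset ι) (w : ι → ℂ) :
    ‖PreFock.ker S w‖ ^ 2 = Real.exp (∑ i ∈ S, ‖w i‖ ^ 2) := by
  have h := inner_self_eq_norm_sq_to_K (𝕜 := ℂ) (PreFock.ker S w)
  rw [PreFock.inner_ker, PreFock.ker_apply,
    Finset.sum_congr rfl fun i hi => by rw [trunc_of_mem hi, Complex.mul_conj']] at h
  have h' : ((Real.exp (∑ i ∈ S, ‖w i‖ ^ 2) : ℝ) : ℂ) = ((‖PreFock.ker S w‖ ^ 2 : ℝ) : ℂ) := by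
    push_cast
    exact h
  exact (Complex.ofReal_injective h').symm

/-- Cauchy–Schwarz against the kernel truncated to the variables of `p`. The constant is independent
of those variables, which makes the extension to the completion possible. -/
theorem PreFock.norm_apply_le (x y : L2 ι) (p : PreFock ι) :
    ‖p.1 (cpoint x y)‖ ≤ Real.exp ((‖x‖ ^ 2 + ‖y‖ ^ 2) / 2) * ‖p‖ := by
  obtain ⟨S, hS⟩ := p.exists_finset
  rw [← hS _ _ fun i hi => trunc_of_mem hi _, ← PreFock.inner_ker]
  refine (norm_inner_le_norm _ _).trans (mul_le_mul_of_nonneg_right ?_ (norm_nonneg _))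
  refine le_of_sq_le_sq ?_ (by positivity)
  rw [PreFock.norm_ker_sq, ← Real.exp_nat_mul]
  refine Real.exp_le_exp.2 ?_
  have := sum_le_hasSum S (fun i _ => by positivity) (hasSum_norm_cpoint_sq x y)
  push_cast
  linarith

/-- Evaluation at a point of the complexified `ℓ₂(ι)` on functions of finitely many variables. -/
def PreFock.evalL (x y : L2 ι) : PreFock ι →L[ℂ] ℂ :=
  LinearMap.mkContinuous
    { toFun := fun p => p.1 (cpoint x y)
      map_add' := fun _ _ => rfl
      map_smul' := fun _ _ => rfl } _ (PreFock.norm_apply_le x y)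

theorem Fock.eval_coe (p : PreFock ι) (x y : L2 ι) :
    Fock.eval (p : Fock ι) x y = p.1 (cpoint x y) :=
  UniformSpace.Completion.extension_coe (PreFock.evalL x y).uniformContinuous p

theorem Fock.continuous_eval (x y : L2 ι) : Continuous fun f : Fock ι => Fock.eval f x y :=
  UniformSpace.Completion.continuous_extension

theorem Fock.eval_add (f g : Fock ι) (x y : L2 ι) :
    Fock.eval (f + g) x y = Fock.eval f x y + Fock.eval g x y := by
  refine UniformSpace.Completion.induction_on₂ f g ?_ fun p q => ?_
  · exact isClosed_eq ((Fock.continuous_eval x y).comp continuous_add)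
      (((Fock.continuous_eval x y).comp continuous_fst).add
        ((Fock.continuous_eval x y).comp continuous_snd))
  · rw [← UniformSpace.Completion.coe_add, Fock.eval_coe, Fock.eval_coe, Fock.eval_coe]
    rfl

theorem Fock.eval_smul (c : ℂ) (f : Fock ι) (x y : L2 ι) :
    Fock.eval (c • f) x y = c * Fock.eval f x y := by
  refine UniformSpace.Completion.induction_on f ?_ fun p => ?_
  · exact isClosed_eq ((Fock.continuous_eval x y).comp (continuous_const_smul c))
      ((Fock.continuous_eval x y).const_mul c)
  · rw [← UniformSpace.Completion.coe_smul, Fock.eval_coe, Fock.eval_coe]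
    rfl

/-- Evaluation as a continuous linear functional on the Fock space. -/
def Fock.evalL (x y : L2 ι) : Fock ι →L[ℂ] ℂ where
  toFun f := Fock.eval f x y
  map_add' f g := Fock.eval_add f g x y
  map_smul' c f := Fock.eval_smul c f x y
  cont := Fock.continuous_eval x y

/-- The vector of the Fock space that represents the evaluation at `x + iy`. -/
def Fock.ker (x y : L2 ι) : Fock ι := (InnerProductSpace.toDual ℂ (Fock ι)).symm (Fock.evalL x y)

theorem Fock.inner_ker (x y : L2 ι) (f : Fock ι) : inner ℂ (Fock.ker x y) f = Fock.eval f x y :=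
  InnerProductSpace.toDual_symm_apply

theorem Fock.norm_eval_le (x y : L2 ι) (f : Fock ι) :
    ‖Fock.eval f x y‖ ≤ Real.exp ((‖x‖ ^ 2 + ‖y‖ ^ 2) / 2) * ‖f‖ := by
  induction f using UniformSpace.Completion.induction_on with
  | hp => exact isClosed_le (Fock.continuous_eval x y).norm (by fun_prop)
  | ih p =>
    rw [Fock.eval_coe, UniformSpace.Completion.norm_coe]
    exact p.norm_apply_le x y

theorem Fock.norm_ker_le (x y : L2 ι) :
    ‖Fock.ker x y‖ ≤ Real.exp ((‖x‖ ^ 2 + ‖y‖ ^ 2) / 2) := by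
  rw [Fock.ker, LinearIsometryEquiv.norm_map]
  exact ContinuousLinearMap.opNorm_le_bound _ (by positivity) (Fock.norm_eval_le x y)

/-- The kernel vectors are the limits of their finite-dimensional truncations. -/
theorem Fock.tendsto_ker (x y : L2 ι) :
    Filter.Tendsto (fun S : Finset ι => (PreFock.ker S (cpoint x y) : Fock ι)) Filter.atTop
      (nhds (Fock.ker x y)) := by
  rw [tendsto_iff_norm_sub_tendsto_zero]
  have hsq : Filter.Tendsto (fun S : Finset ι => Real.exp (‖x‖ ^ 2 + ‖y‖ ^ 2) -
      Real.exp (∑ i ∈ S, ‖cpoint x y i‖ ^ 2)) Filter.atTop (nhds 0) := by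
    have h := ((Real.continuous_exp.tendsto _).comp (hasSum_norm_cpoint_sq x y)).const_sub
      (Real.exp (‖x‖ ^ 2 + ‖y‖ ^ 2))
    rwa [sub_self] at h
  -- The truncated kernel `k_S` satisfies `⟨k, k_S⟩ = ‖k_S‖²`, so `‖k_S - k‖² = ‖k‖² - ‖k_S‖²`; the
  -- upper bound on `‖k‖` is enough here.
  have hb : ∀ S : Finset ι, ‖(PreFock.ker S (cpoint x y) : Fock ι) - Fock.ker x y‖ ^ 2 ≤
      Real.exp (‖x‖ ^ 2 + ‖y‖ ^ 2) - Real.exp (∑ i ∈ S, ‖cpoint x y i‖ ^ 2) := by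
    intro S
    have h1 : inner ℂ (Fock.ker x y) (PreFock.ker S (cpoint x y) : Fock ι) =
        ((Real.exp (∑ i ∈ S, ‖cpoint x y i‖ ^ 2) : ℝ) : ℂ) := by
      rw [Fock.inner_ker, Fock.eval_coe, PreFock.ker_apply, sum_cpoint_mul_conj,
        Complex.ofReal_exp]
    have h2 : ‖Fock.ker x y‖ ^ 2 ≤ Real.exp (‖x‖ ^ 2 + ‖y‖ ^ 2) := by
      refine (pow_le_pow_left₀ (norm_nonneg _) (Fock.norm_ker_le x y) 2).trans_eq ?_
      rw [← Real.exp_nat_mul]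
      congr 1
      push_cast
      ring
    rw [norm_sub_rev, norm_sub_sq (𝕜 := ℂ), h1, UniformSpace.Completion.norm_coe,
      PreFock.norm_ker_sq, RCLike.re_eq_complex_re, Complex.ofReal_re]
    linarith
  have h0 := squeeze_zero (fun S => sq_nonneg _) hb hsq
  have := h0.sqrt
  simpa [Real.sqrt_sq] using this

theorem Fock.inner_ker_ker (x y x' y' : L2 ι) :
    inner ℂ (Fock.ker x y) (Fock.ker x' y') = Complex.exp (cinner x y x' y') := by
  have h1 : Filter.Tendsto (fun S : Finset ι => inner ℂ (Fock.ker x y)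
      (PreFock.ker S (cpoint x' y') : Fock ι)) Filter.atTop
      (nhds (inner ℂ (Fock.ker x y) (Fock.ker x' y'))) :=
    tendsto_const_nhds.inner (Fock.tendsto_ker x' y')
  have h2 := (Complex.continuous_exp.tendsto _).comp (hasSum_cinner x y x' y')
  refine tendsto_nhds_unique h1 (h2.congr fun S => ?_)
  rw [Fock.inner_ker, Fock.eval_coe, PreFock.ker_apply]
  rfl

theorem memℓp_of_finite_support {f : ι → ℝ} (hf : f.support.Finite) : Memℓp f 2 :=
  (memℓp_zero hf).of_exponent_ge zero_le

/-- An element of the Fock space is determined by its values at the points with finitely many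
nonzero coordinates. -/
theorem Fock.ext_of_finite_support {f f' : Fock ι}
    (h : ∀ x y : L2 ι, (x : ι → ℝ).support.Finite → (y : ι → ℝ).support.Finite →
      Fock.eval f x y = Fock.eval f' x y) : f = f' := by
  have hk : ∀ (S : Finset ι) (w : ι → ℂ), inner ℂ (PreFock.ker S w : Fock ι) (f - f') = 0 := by
    intro S w
    have hsup (r : ℂ → ℝ) (hr : r 0 = 0) : (fun i => r (trunc S w i)).support.Finite := by
      refine S.finite_toSet.subset fun i hi => ?_
      by_contra hiS
      exact hi (by simp only [trunc_of_notMem hiS, hr])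
    let x : L2 ι := ⟨_, memℓp_of_finite_support (hsup Complex.re rfl)⟩
    let y : L2 ι := ⟨_, memℓp_of_finite_support (hsup Complex.im rfl)⟩
    -- Pairing with a truncated coherent state is thus evaluation at a finitely supported point,
    -- where `f` and `f'` agree.
    have hxy : cpoint x y = trunc S w := funext fun i => Complex.re_add_im _
    have hin : ∀ g : Fock ι, inner ℂ (PreFock.ker S w : Fock ι) g = Fock.eval g x y := by
      intro g
      induction g using UniformSpace.Completion.induction_on with
      | hp => exact isClosed_eq (by fun_prop) (Fock.continuous_eval x y)
      | ih p => rw [UniformSpace.Completion.inner_coe, PreFock.inner_ker, Fock.eval_coe, hxy]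
    rw [inner_sub_right, hin, hin, h x y (hsup Complex.re rfl) (hsup Complex.im rfl), sub_self]
  have hall : ∀ g : Fock ι, inner ℂ g (f - f') = 0 := by
    intro g
    induction g using UniformSpace.Completion.induction_on with
    | hp => exact isClosed_eq (by fun_prop) continuous_const
    | ih p =>
      have hcl : IsClosed {q : PreFock ι | inner ℂ (q : Fock ι) (f - f') = 0} :=
        isClosed_eq ((UniformSpace.Completion.continuous_coe _).inner continuous_const)
          continuous_const
      refine closure_minimal (fun q hq => ?_) hcl p.mem_closure_span_ker
      induction hq using Submodule.span_induction with
      | mem q hq =>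
        obtain ⟨⟨S, w⟩, rfl⟩ := hq
        exact hk S w
      | zero => exact inner_zero_left _
      | add a b _ _ ha hb =>
        simp only [Set.mem_ofPred_eq] at ha hb ⊢
        rw [UniformSpace.Completion.coe_add, inner_add_left, ha, hb, add_zero]
      | smul c a _ ha =>
        simp only [Set.mem_ofPred_eq] at ha ⊢
        rw [UniformSpace.Completion.coe_smul, inner_smul_left, ha, mul_zero]
  exact sub_eq_zero.1 (inner_self_eq_zero.1 (hall (f - f')))

theorem Fock.ext_eval {f f' : Fock ι} (h : ∀ x y, Fock.eval f x y = Fock.eval f' x y) : f = f' :=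
  Fock.ext_of_finite_support fun x y _ _ => h x y

theorem Fock.dense_span_ker :
    (Submodule.span ℂ (Set.range fun q : L2 ι × L2 ι => Fock.ker q.1 q.2)).topologicalClosure
      = ⊤ := by
  rw [Submodule.topologicalClosure_eq_top_iff, Submodule.eq_bot_iff]
  intro f hf
  refine Fock.ext_eval fun x y => ?_
  rw [← Fock.inner_ker, ← Fock.inner_ker, inner_zero_right]
  exact hf _ (Submodule.subset_span ⟨(x, y), rfl⟩)

theorem one_eq_ker : Fock.one ι = Fock.ker 0 0 := by
  refine Fock.ext_eval fun x y => ?_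
  rw [← Fock.inner_ker x y (Fock.ker 0 0), Fock.inner_ker_ker, Fock.one, Fock.eval_coe]
  simp [cinner, PreFock.one]

/-- Two total families of vectors with equal Gram matrices are related by a unitary operator. -/
theorem exists_linearIsometryEquiv_of_inner_eq {X F : Type*} [NormedAddCommGroup F]
    [InnerProductSpace ℂ F] [CompleteSpace F] (φ ψ : X → F)
    (h : ∀ a b, inner ℂ (φ a) (φ b) = inner ℂ (ψ a) (ψ b))
    (hφ : (Submodule.span ℂ (Set.range φ)).topologicalClosure = ⊤)
    (hψ : (Submodule.span ℂ (Set.range ψ)).topologicalClosure = ⊤) :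
    ∃ J : F ≃ₗᵢ[ℂ] F, ∀ a, J (φ a) = ψ a := by
  have hd : ∀ χ : X → F, (Submodule.span ℂ (Set.range χ)).topologicalClosure = ⊤ →
      DenseRange (Finsupp.linearCombination ℂ χ) := by
    intro χ hχ
    rw [DenseRange, ← LinearMap.coe_range, Finsupp.range_linearCombination]
    exact Submodule.dense_iff_topologicalClosure_eq_top.2 hχ
  -- The norm of a finite combination depends on the Gram matrix alone, so the correspondence of
  -- combinations is isometric and extends by density.
  have hin : ∀ χ : X → F, ∀ c, ((‖Finsupp.linearCombination ℂ χ c‖ ^ 2 : ℝ) : ℂ) =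
      c.sum fun a r => c.sum fun b t => starRingEnd ℂ r * (t * inner ℂ (χ a) (χ b)) := by
    intro χ c
    have := inner_self_eq_norm_sq_to_K (𝕜 := ℂ) (Finsupp.linearCombination ℂ χ c)
    push_cast
    refine this.symm.trans ?_
    simp only [Finsupp.linearCombination_apply, Finsupp.sum, sum_inner, inner_sum,
      inner_smul_left, inner_smul_right, Finset.mul_sum]
    rw [Finset.sum_comm]
    exact Finset.sum_congr rfl fun a _ => Finset.sum_congr rfl fun b _ => by ring
  have hn : ∀ c, ‖Finsupp.linearCombination ℂ ψ (LinearEquiv.refl ℂ (X →₀ ℂ) c)‖ =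
      ‖Finsupp.linearCombination ℂ φ c‖ := by
    intro c
    have h1 := hin φ c
    simp only [h, ← hin ψ c] at h1
    exact ((pow_left_inj₀ (norm_nonneg _) (norm_nonneg _) two_ne_zero).1
      (Complex.ofReal_injective h1)).symm
  refine ⟨(LinearEquiv.refl ℂ (X →₀ ℂ)).extendOfIsometry _ _ (hd φ hφ) (hd ψ hψ) hn, fun a => ?_⟩
  have := LinearEquiv.extendOfIsometry_eq (LinearEquiv.refl ℂ (X →₀ ℂ)) _ _ (hd φ hφ)
    (hd ψ hψ) hn (Finsupp.single a 1)
  simpa using this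

end

/-! ### The representation of the affine isometry group in the Fock space. -/

section

variable {ι : Type}

/-- The multiplier of the translation by `v` at the point `x + iy`. -/
def translationWeight (v x y : L2 ι) : ℂ :=
  Complex.exp (-(((inner ℝ x v : ℝ) : ℂ) + ((inner ℝ y v : ℝ) : ℂ) * Complex.I) -
    ((inner ℝ v v : ℝ) : ℂ) / 2)

/-- Every affine isometry of `ℓ₂(ι)` acts in the Fock space by a unitary operator. -/
theorem exists_expOperator (T : L2 ι ≃ᵃⁱ[ℝ] L2 ι) :
    ∃ E : Fock ι ≃ₗᵢ[ℂ] Fock ι, ∀ (f : Fock ι) (x y : L2 ι), Fock.eval (E f) x y =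
      Fock.eval f (T.linearIsometryEquiv.symm (x + T 0)) (T.linearIsometryEquiv.symm y) *
        translationWeight (T 0) x y := by
  set A := T.linearIsometryEquiv
  set v := T 0
  set φ : L2 ι × L2 ι → Fock ι := fun q => Fock.ker q.1 q.2
  -- The vector `ψ (x, y)` represents the functional `f ↦ (E f)(x + iy)`, so it is the image of the
  -- kernel at `x + iy` under the adjoint of the operator `E` sought.
  set ψ : L2 ι × L2 ι → Fock ι := fun q =>
    starRingEnd ℂ (translationWeight v q.1 q.2) • Fock.ker (A.symm (q.1 + v)) (A.symm q.2)
  -- Multipliers are nonzero and the points `A⁻¹ (x + v) + i A⁻¹ y` exhaust the space, so the `ψ`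
  -- span all the kernels.
  have hψ : (Submodule.span ℂ (Set.range ψ)).topologicalClosure = ⊤ := by
    refine top_le_iff.1 (Fock.dense_span_ker.symm.le.trans
      (Submodule.topologicalClosure_mono (Submodule.span_le.2 ?_)))
    rintro _ ⟨⟨x, y⟩, rfl⟩
    have hne : starRingEnd ℂ (translationWeight v (A x - v) (A y)) ≠ 0 :=
      (map_ne_zero _).2 (Complex.exp_ne_zero _)
    have h : ψ (A x - v, A y) ∈ Submodule.span ℂ (Set.range ψ) := Submodule.subset_span ⟨_, rfl⟩
    have h' := Submodule.smul_mem _ (starRingEnd ℂ (translationWeight v (A x - v) (A y)))⁻¹ h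
    simpa [ψ, smul_smul, inv_mul_cancel₀ hne] using h'
  obtain ⟨J, hJ⟩ := exists_linearIsometryEquiv_of_inner_eq φ ψ (fun ⟨x, y⟩ ⟨x', y'⟩ => by
    simp only [φ, ψ, inner_smul_left, inner_smul_right, Fock.inner_ker_ker, Complex.conj_conj]
    simp only [translationWeight, ← Complex.exp_conj, ← Complex.exp_add]
    congr 1
    simp only [cinner, LinearIsometryEquiv.inner_map_map, inner_add_left, inner_add_right,
      map_sub, map_neg, map_add, map_mul, map_div₀, Complex.conj_ofReal, Complex.conj_I,
      map_ofNat, Complex.ofReal_add, real_inner_comm v]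
    ring) Fock.dense_span_ker hψ
  -- The unitary `J` is the adjoint of `E`, whence the inverse.
  refine ⟨J.symm, fun f x y => ?_⟩
  rw [← Fock.inner_ker, ← J.inner_map_map, J.apply_symm_apply]
  have := hJ (x, y)
  simp only [φ, ψ] at this
  rw [this, inner_smul_left, Complex.conj_conj, Fock.inner_ker, mul_comm]

/-- The unitary operator of the Fock space that corresponds to an affine isometry. -/
def expOperator (T : L2 ι ≃ᵃⁱ[ℝ] L2 ι) : Fock ι ≃ₗᵢ[ℂ] Fock ι := (exists_expOperator T).choose

theorem eval_expOperator (T : L2 ι ≃ᵃⁱ[ℝ] L2 ι) (f : Fock ι) (x y : L2 ι) :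
    Fock.eval (expOperator T f) x y =
      Fock.eval f (T.linearIsometryEquiv.symm (x + T 0)) (T.linearIsometryEquiv.symm y) *
        translationWeight (T 0) x y :=
  (exists_expOperator T).choose_spec f x y

theorem affineIsometryEquiv_apply (T : L2 ι ≃ᵃⁱ[ℝ] L2 ι) (x : L2 ι) :
    T x = T.linearIsometryEquiv x + T 0 := by
  simpa using T.map_vadd 0 x

/-- The representation of the group of affine isometries of `ℓ₂(ι)` in the Fock space. -/
def expHom : (L2 ι ≃ᵃⁱ[ℝ] L2 ι) →* (Fock ι ≃ₗᵢ[ℂ] Fock ι) :=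
  MonoidHom.mk' expOperator fun T R => by
    refine LinearIsometryEquiv.ext fun f => Fock.ext_eval fun x y => ?_
    set A := T.linearIsometryEquiv with hA
    set B := R.linearIsometryEquiv with hB
    have hlin : (T * R).linearIsometryEquiv.symm = A.symm.trans B.symm := rfl
    have h0 : (T * R) 0 = A (R 0) + T 0 := affineIsometryEquiv_apply T (R 0)
    rw [LinearIsometryEquiv.coe_mul, Function.comp_apply, eval_expOperator, eval_expOperator,
      eval_expOperator, hlin, h0, mul_assoc]
    congr 1
    · simp only [LinearIsometryEquiv.trans_apply, map_add, LinearIsometryEquiv.symm_apply_apply]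
      congr 1
      abel
    -- The cross term `⟨T 0, A (R 0)⟩` arising from the shifted argument is exactly the one in `‖A
    -- (R 0) + T 0‖² / 2`; the real inner product is symmetric, so no phase remains.
    · have hs (a b : L2 ι) : inner ℝ (A.symm a) b = inner ℝ a (A b) := by
        rw [← A.inner_map_map, A.apply_symm_apply]
      simp only [translationWeight, ← Complex.exp_add]
      congr 1
      rw [← hA]
      simp only [hs, inner_add_left, inner_add_right, Complex.ofReal_add, A.inner_map_map,
        real_inner_comm (T 0)]
      ring

theorem expHom_apply (T : L2 ι ≃ᵃⁱ[ℝ] L2 ι) : expHom T = expOperator T := rfl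

theorem isExp_expHom : IsExp (expHom : (L2 ι ≃ᵃⁱ[ℝ] L2 ι) →* (Fock ι ≃ₗᵢ[ℂ] Fock ι)) where
  orthogonal A f x y := by
    have h0 : A.toAffineIsometryEquiv 0 = 0 := A.map_zero
    have hlin : A.toAffineIsometryEquiv.linearIsometryEquiv = A := by ext; rfl
    rw [expHom_apply, eval_expOperator, h0, hlin]
    simp [translationWeight]
  translation v f x y := by
    have h0 : AffineIsometryEquiv.constVAdd ℝ (L2 ι) v 0 = v := add_zero v
    have hlin : (AffineIsometryEquiv.constVAdd ℝ (L2 ι) v).linearIsometryEquiv =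
      LinearIsometryEquiv.refl ℝ _ := by ext; rfl
    rw [expHom_apply, eval_expOperator, h0, hlin]
    rfl

/-- Translations and orthogonal operators generate the affine isometries, and on both the conditions
prescribe all values of the image. -/
theorem IsExp.eq {E E' : (L2 ι ≃ᵃⁱ[ℝ] L2 ι) →* (Fock ι ≃ₗᵢ[ℂ] Fock ι)} (h : IsExp E)
    (h' : IsExp E') : E = E' := by
  refine MonoidHom.ext fun T => ?_
  have hT : T = AffineIsometryEquiv.constVAdd ℝ (L2 ι) (T 0) *
      T.linearIsometryEquiv.toAffineIsometryEquiv := by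
    refine AffineIsometryEquiv.ext fun x => ?_
    rw [affineIsometryEquiv_apply, add_comm]
    rfl
  rw [hT, map_mul, map_mul]
  congr 1
  · exact LinearIsometryEquiv.ext fun f => Fock.ext_eval fun x y => by
      rw [h.translation, h'.translation]
  · exact LinearIsometryEquiv.ext fun f => Fock.ext_eval fun x y => by
      rw [h.orthogonal, h'.orthogonal]

end

section

/-! ### The affine isometric action -/

section PermL2

variable {ι : Type}

theorem memℓp_comp_equiv (e : ι ≃ ι) (x : L2 ι) : Memℓp (fun i => x (e i)) 2 := by
  have h := lp.memℓp x
  rw [memℓp_gen_iff (by norm_num)] at h ⊢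
  exact (e.summable_iff (f := fun i => ‖x i‖ ^ (2 : ENNReal).toReal)).2 h

/-- The permutation of the coordinates of `ℓ₂(ι)`. -/
def permL2 (e : ι ≃ ι) : L2 ι ≃ₗᵢ[ℝ] L2 ι where
  toFun x := ⟨fun i => x (e.symm i), memℓp_comp_equiv e.symm x⟩
  invFun x := ⟨fun i => x (e i), memℓp_comp_equiv e x⟩
  map_add' _ _ := rfl
  map_smul' _ _ := rfl
  left_inv x := lp.ext (funext fun i => congrArg x (e.symm_apply_apply i))
  right_inv x := lp.ext (funext fun i => congrArg x (e.apply_symm_apply i))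
  norm_map' x := by
    have h (z : L2 ι) : ‖z‖ = (∑' i, ‖z i‖ ^ (2 : ENNReal).toReal) ^ (1 / (2 : ENNReal).toReal) :=
      lp.norm_eq_tsum_rpow (by norm_num) z
    rw [h, h x]
    congr 1
    exact e.symm.tsum_eq fun i => ‖x i‖ ^ (2 : ENNReal).toReal

theorem permL2_symm_apply (e : ι ≃ ι) (x : L2 ι) (i : ι) : (permL2 e).symm x i = x (e i) := rfl

end PermL2

theorem Xi_apply (s : ℝ) (g : GG) (p : ℕ × ℕ) : Xi s g p =
    (if (g.1 : Equiv.Perm ℕ).symm p.1 = (g.2 : Equiv.Perm ℕ).symm p.2 then s else 0) -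
      if p.1 = p.2 then s else 0 := rfl

theorem Xi_mul (s : ℝ) (g₁ g₂ : GG) : Xi s (g₁ * g₂) = UU g₁ (Xi s g₂) + Xi s g₁ := by
  simp only [Xi, map_mul, map_sub, Module.End.mul_apply]
  abel

theorem Xi_of_mem_KK (s : ℝ) {k : GG} (hk : k ∈ KK) : Xi s k = 0 := by
  obtain ⟨σ, rfl⟩ := hk
  ext p
  simp [Xi_apply]

theorem not_memℓp_eta {s : ℝ} (hs : s ≠ 0) : ¬ Memℓp (eta s) 2 := by
  intro h
  rw [memℓp_gen_iff (by norm_num)] at h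
  have h1 := h.comp_injective (i := fun n : ℕ => (n, n)) fun a b hab => (Prod.mk.inj hab).1
  have h2 : Summable fun _ : ℕ => ‖s‖ ^ (2 : ENNReal).toReal := by
    refine h1.congr fun n => ?_
    simp [eta]
  rw [summable_const_iff] at h2
  have : (0 : ℝ) < ‖s‖ ^ (2 : ENNReal).toReal := Real.rpow_pos_of_pos (norm_pos_iff.2 hs) _
  exact this.ne' h2

/-- The two components of an element of `G` differ only at finitely many points. -/
theorem finite_setOf_ne (g : GG) :
    {i : ℕ | (g.1 : Equiv.Perm ℕ) i ≠ (g.2 : Equiv.Perm ℕ) i}.Finite := by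
  refine (Set.Finite.union g.1.2 g.2.2).subset fun i hi => ?_
  by_contra h
  simp only [Set.mem_union, not_or] at h
  exact hi ((not_not.1 h.1).trans (not_not.1 h.2).symm)

section Support

variable (g : GG)

/-- The indices of the positive coordinates of `Ξ(g)`. -/
def XiPos : Finset (ℕ × ℕ) := (finite_setOf_ne g).toFinset.image fun j =>
  ((g.1 : Equiv.Perm ℕ) j, (g.2 : Equiv.Perm ℕ) j)

/-- The indices of the negative coordinates of `Ξ(g)`. -/
def XiNeg : Finset (ℕ × ℕ) := (finite_setOf_ne g).toFinset.image fun j =>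
  ((g.1 : Equiv.Perm ℕ) j, (g.1 : Equiv.Perm ℕ) j)

theorem Xi_of_mem_XiPos (s : ℝ) {p : ℕ × ℕ} (hp : p ∈ XiPos g) : Xi s g p = s := by
  simp only [XiPos, Finset.mem_image, Set.Finite.mem_toFinset, Set.mem_ofPred_eq] at hp
  obtain ⟨j, hj, rfl⟩ := hp
  simp [Xi_apply, hj]

theorem Xi_of_mem_XiNeg (s : ℝ) {p : ℕ × ℕ} (hp : p ∈ XiNeg g) : Xi s g p = -s := by
  simp only [XiNeg, Finset.mem_image, Set.Finite.mem_toFinset, Set.mem_ofPred_eq] at hp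
  obtain ⟨j, hj, rfl⟩ := hp
  have : j ≠ (g.2 : Equiv.Perm ℕ).symm ((g.1 : Equiv.Perm ℕ) j) := fun h =>
    hj ((Equiv.eq_symm_apply _).1 h).symm
  simp [Xi_apply, this]

theorem Xi_of_notMem (s : ℝ) {p : ℕ × ℕ} (hp : p ∉ XiPos g ∪ XiNeg g) : Xi s g p = 0 := by
  obtain ⟨a, b⟩ := p
  -- At the point `(σ j, τ l)`, the moved `η` is nonzero when `j = l` and `η` itself when `σ j = τ
  -- l`; the two cancel when both hold.
  obtain ⟨j, rfl⟩ := (g.1 : Equiv.Perm ℕ).surjective a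
  obtain ⟨l, rfl⟩ := (g.2 : Equiv.Perm ℕ).surjective b
  simp only [XiPos, XiNeg, Finset.mem_union, Finset.mem_image, Set.Finite.mem_toFinset,
    Set.mem_ofPred_eq, Prod.mk.injEq, not_or, not_exists, not_and] at hp
  simp only [Xi_apply, Equiv.symm_apply_apply]
  by_cases hjl : j = l
  · subst hjl
    have : (g.1 : Equiv.Perm ℕ) j = (g.2 : Equiv.Perm ℕ) j := by
      by_contra h
      exact hp.1 j h rfl rfl
    simp [this]
  · have : (g.1 : Equiv.Perm ℕ) j ≠ (g.2 : Equiv.Perm ℕ) l := by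
      intro h
      refine hp.2 j (fun h' => hjl ?_) rfl h
      exact (g.2 : Equiv.Perm ℕ).injective (h'.symm.trans h)
    simp [this, hjl]

theorem disjoint_XiPos_XiNeg : Disjoint (XiPos g) (XiNeg g) := by
  rw [Finset.disjoint_left]
  intro p hp hn
  -- With `s = 1`, a common index would carry both values `1` and `-1`.
  have h1 := Xi_of_mem_XiPos g 1 hp
  rw [Xi_of_mem_XiNeg g 1 hn] at h1
  norm_num at h1

theorem card_XiPos : (XiPos g).card =
    {i : ℕ | (g.1 : Equiv.Perm ℕ) i ≠ (g.2 : Equiv.Perm ℕ) i}.ncard := by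
  rw [XiPos, Finset.card_image_of_injective _ fun a b h =>
    (g.1 : Equiv.Perm ℕ).injective (Prod.mk.inj h).1, Set.ncard_eq_toFinset_card _
    (finite_setOf_ne g)]

theorem card_XiNeg : (XiNeg g).card =
    {i : ℕ | (g.1 : Equiv.Perm ℕ) i ≠ (g.2 : Equiv.Perm ℕ) i}.ncard := by
  rw [XiNeg, Finset.card_image_of_injective _ fun a b h =>
    (g.1 : Equiv.Perm ℕ).injective (Prod.mk.inj h).1, Set.ncard_eq_toFinset_card _
    (finite_setOf_ne g)]

theorem memℓp_Xi (s : ℝ) : Memℓp (Xi s g) 2 := by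
  refine memℓp_of_finite_support ((XiPos g ∪ XiNeg g).finite_toSet.subset fun p hp => ?_)
  by_contra h
  exact hp (Xi_of_notMem g s h)

/-- The cocycle `Ξ` with values in `ℓ₂ ⊗ ℓ₂`. -/
def XiL2 (s : ℝ) : L2 (ℕ × ℕ) := ⟨Xi s g, memℓp_Xi g s⟩

theorem inner_XiL2_self (s : ℝ) : inner ℝ (XiL2 g s) (XiL2 g s) =
    2 * s ^ 2 * {i : ℕ | (g.1 : Equiv.Perm ℕ) i ≠ (g.2 : Equiv.Perm ℕ) i}.ncard := by
  have h : ∀ p, inner ℝ (XiL2 g s p) (XiL2 g s p) = Xi s g p ^ 2 := fun p => by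
    rw [real_inner_self_eq_norm_sq, Real.norm_eq_abs, sq_abs]
    rfl
  rw [lp.inner_eq_tsum]
  simp only [h]
  rw [tsum_eq_sum (s := XiPos g ∪ XiNeg g) fun p hp => by
      rw [Xi_of_notMem g s hp, zero_pow two_ne_zero],
    Finset.sum_union (disjoint_XiPos_XiNeg g),
    Finset.sum_congr rfl fun p hp => by rw [Xi_of_mem_XiPos g s hp],
    Finset.sum_congr (s₁ := XiNeg g) rfl fun p hp => by rw [Xi_of_mem_XiNeg g s hp],
    Finset.sum_const, Finset.sum_const, card_XiPos, card_XiNeg]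
  simp only [nsmul_eq_mul]
  ring

end Support

/-- The permutation of the index set `ℕ × ℕ` by an element of `G`. -/
def pairPerm (g : GG) : ℕ × ℕ ≃ ℕ × ℕ :=
  Equiv.prodCongr (g.1 : Equiv.Perm ℕ) (g.2 : Equiv.Perm ℕ)

/-- The affine isometric action of `G` on `ℓ₂ ⊗ ℓ₂`. -/
def affineAction (s : ℝ) : GG →* (L2 (ℕ × ℕ) ≃ᵃⁱ[ℝ] L2 (ℕ × ℕ)) :=
  MonoidHom.mk' (fun g => AffineIsometryEquiv.constVAdd ℝ (L2 (ℕ × ℕ)) (XiL2 g s) *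
    (permL2 (pairPerm g)).toAffineIsometryEquiv) fun g₁ g₂ => by
    refine AffineIsometryEquiv.ext fun x => lp.ext (funext fun p => ?_)
    change Xi s (g₁ * g₂) p + UU (g₁ * g₂) x p = Xi s g₁ p + UU g₁ (Xi s g₂ + UU g₂ x) p
    rw [Xi_mul, map_add, map_mul]
    simp only [Pi.add_apply, Module.End.mul_apply]
    ring

theorem affineAction_apply (s : ℝ) (g : GG) : affineAction s g =
    AffineIsometryEquiv.constVAdd ℝ (L2 (ℕ × ℕ)) (XiL2 g s) *
      (permL2 (pairPerm g)).toAffineIsometryEquiv := rfl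

theorem coe_affineAction (s : ℝ) (g : GG) (h : L2 (ℕ × ℕ)) :
    (affineAction s g h : ℕ × ℕ → ℝ) = UU g h + Xi s g := by
  rw [add_comm]
  rfl

theorem affineAction_of_mem_KK (s : ℝ) {k : GG} (hk : k ∈ KK) :
    affineAction s k = (permL2 (pairPerm k)).toAffineIsometryEquiv := by
  have h : XiL2 k s = 0 := Subtype.ext (Xi_of_mem_KK s hk)
  rw [affineAction_apply, h]
  refine AffineIsometryEquiv.ext fun x => ?_
  exact zero_add _

end

section

/-! ### The spherical vector -/

theorem eval_one {ι : Type} (x y : L2 ι) : Fock.eval (Fock.one ι) x y = 1 :=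
  Fock.eval_coe (PreFock.one ι) x y

theorem inner_one {ι : Type} (f : Fock ι) : inner ℂ (Fock.one ι) f = Fock.eval f 0 0 := by
  rw [one_eq_ker, Fock.inner_ker]

theorem norm_one_fock {ι : Type} : ‖Fock.one ι‖ = 1 := by
  have h := inner_self_eq_norm_sq_to_K (𝕜 := ℂ) (Fock.one ι)
  rw [inner_one, eval_one] at h
  have h' : ((1 : ℝ) : ℂ) = ((‖Fock.one ι‖ ^ 2 : ℝ) : ℂ) := by
    push_cast
    exact h
  exact (pow_eq_one_iff_of_nonneg (norm_nonneg _) two_ne_zero).1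
    (Complex.ofReal_injective h').symm

/-- The finite permutation of `ℕ` that exchanges the intervals `[0, N)` and `[N, 2N)`. -/
theorem exists_sInf_shift (N : ℕ) : ∃ σ : SInf, ∀ i < N, N ≤ (σ : Equiv.Perm ℕ) i := by
  let f : ℕ → ℕ := fun i => if i < N then i + N else if i < 2 * N then i - N else i
  have hf : Function.Involutive f := by
    intro i
    simp only [f]
    split_ifs <;> omega
  refine ⟨⟨hf.toPerm f, (Set.finite_lt_nat (2 * N)).subset fun i hi => ?_⟩, fun i hi => ?_⟩
  · by_contra h
    simp only [Set.mem_ofPred_eq, not_lt] at h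
    refine hi ?_
    change f i = i
    simp only [f]
    split_ifs <;> omega
  · change N ≤ f i
    simp only [f, if_pos hi]
    omega

theorem exists_bound_of_finite {S : Set (ℕ × ℕ)} (hS : S.Finite) :
    ∃ N : ℕ, ∀ p ∈ S, p.1 < N ∧ p.2 < N := by
  obtain ⟨a, ha⟩ := (hS.image Prod.fst).bddAbove
  obtain ⟨b, hb⟩ := (hS.image Prod.snd).bddAbove
  refine ⟨max a b + 1, fun p hp => ?_⟩
  have h1 := ha ⟨p, hp, rfl⟩
  have h2 := hb ⟨p, hp, rfl⟩
  exact ⟨by omega, by omega⟩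

/-- A function invariant under the simultaneous finite permutations of the rows and the columns
is constant. -/
theorem eval_eq_of_invariant {f : Fock (ℕ × ℕ)}
    (hf : ∀ k ∈ KK, ∀ x y, Fock.eval f x y =
      Fock.eval f ((permL2 (pairPerm k)).symm x) ((permL2 (pairPerm k)).symm y))
    {x y : L2 (ℕ × ℕ)} (hx : (x : ℕ × ℕ → ℝ).support.Finite)
    (hy : (y : ℕ × ℕ → ℝ).support.Finite) :
    Fock.eval f x y = Fock.eval f 0 0 := by
  refine eq_of_forall_dist_le fun ε hε => ?_
  set C := Real.exp ((‖x‖ ^ 2 + ‖y‖ ^ 2) / 2) with hC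
  have hC1 : 1 ≤ C := Real.one_le_exp (by positivity)
  -- The tolerance is `ε / (2 C)` because the error of approximation enters at two points, amplified
  -- by at most `C` each time.
  obtain ⟨p, hp⟩ := (UniformSpace.Completion.denseRange_coe (α := PreFock (ℕ × ℕ))).exists_dist_lt
    f (show 0 < ε / (2 * C) by positivity)
  rw [dist_eq_norm] at hp
  obtain ⟨S, hS⟩ := p.exists_finset
  obtain ⟨N, hN⟩ := exists_bound_of_finite ((hx.union hy).union S.finite_toSet)
  -- The supports of `x` and `y` and the variables of `p` lie in the square of side `N`, and `σ`
  -- sends `[0, N)` beyond it; the moved points therefore vanish on all variables of `p`.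
  obtain ⟨σ, hσ⟩ := exists_sInf_shift N
  have hk : ((σ, σ) : GG) ∈ KK := ⟨σ, rfl⟩
  set A := permL2 (pairPerm (σ, σ))
  have hz (u : L2 (ℕ × ℕ)) (hu : ∀ q ∈ (u : ℕ × ℕ → ℝ).support, q.1 < N ∧ q.2 < N)
      (q : ℕ × ℕ) (hq : q ∈ S) : A.symm u q = 0 := by
    rw [permL2_symm_apply]
    by_contra h
    exact absurd (hu _ h).1 (not_lt.2 (hσ q.1 (hN q (Or.inr hq)).1))
  have hp0 : Fock.eval (p : Fock (ℕ × ℕ)) (A.symm x) (A.symm y) =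
      Fock.eval (p : Fock (ℕ × ℕ)) 0 0 := by
    rw [Fock.eval_coe, Fock.eval_coe]
    refine hS _ _ fun q hq => ?_
    simp [cpoint, hz x (fun r hr => hN r (Or.inl (Or.inl hr))) q hq,
      hz y (fun r hr => hN r (Or.inl (Or.inr hr))) q hq]
  have hsub (u v : L2 (ℕ × ℕ)) : Fock.eval f u v - Fock.eval (p : Fock (ℕ × ℕ)) u v =
      Fock.eval (f - (p : Fock (ℕ × ℕ))) u v := ((Fock.evalL u v).map_sub _ _).symm
  -- Orthogonality of `A` keeps the constant `C` independent of the chosen shift.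
  have h1 := Fock.norm_eval_le (A.symm x) (A.symm y) (f - (p : Fock (ℕ × ℕ)))
  rw [LinearIsometryEquiv.norm_map, LinearIsometryEquiv.norm_map, ← hC] at h1
  have h2 := Fock.norm_eval_le 0 0 (f - (p : Fock (ℕ × ℕ)))
  have h2' : ‖Fock.eval (f - (p : Fock (ℕ × ℕ))) 0 0‖ ≤ C * ‖f - (p : Fock (ℕ × ℕ))‖ :=
    h2.trans (mul_le_mul_of_nonneg_right (by simpa using hC1) (norm_nonneg _))
  rw [dist_eq_norm, hf _ hk x y]
  calc ‖Fock.eval f (A.symm x) (A.symm y) - Fock.eval f 0 0‖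
      = ‖Fock.eval (f - (p : Fock (ℕ × ℕ))) (A.symm x) (A.symm y) -
          Fock.eval (f - (p : Fock (ℕ × ℕ))) 0 0‖ := by
        rw [← hsub, ← hsub, hp0]
        congr 1
        ring
    _ ≤ C * ‖f - (p : Fock (ℕ × ℕ))‖ + C * ‖f - (p : Fock (ℕ × ℕ))‖ :=
        (norm_sub_le _ _).trans (add_le_add h1 h2')
    _ ≤ C * (ε / (2 * C)) + C * (ε / (2 * C)) := by gcongr
    _ = ε := by
        field_simp
        norm_num

theorem eval_expHom_of_mem_KK (s : ℝ) {k : GG} (hk : k ∈ KK) (f : Fock (ℕ × ℕ))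
    (x y : L2 (ℕ × ℕ)) : Fock.eval (expHom (affineAction s k) f) x y =
      Fock.eval f ((permL2 (pairPerm k)).symm x) ((permL2 (pairPerm k)).symm y) := by
  rw [affineAction_of_mem_KK s hk, isExp_expHom.orthogonal]

/-- The constants are the only vectors fixed by the diagonal subgroup. -/
theorem fixed_iff (s : ℝ) (f : Fock (ℕ × ℕ)) :
    (∀ k ∈ KK, expHom (affineAction s k) f = f) ↔ ∃ c : ℂ, f = c • Fock.one (ℕ × ℕ) := by
  constructor
  · intro h
    refine ⟨Fock.eval f 0 0, Fock.ext_of_finite_support fun x y hx hy => ?_⟩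
    rw [Fock.eval_smul, eval_one, mul_one]
    refine eval_eq_of_invariant (fun k hk x y => ?_) hx hy
    rw [← eval_expHom_of_mem_KK s hk, h k hk]
  · rintro ⟨c, rfl⟩ k hk
    refine Fock.ext_eval fun x y => ?_
    rw [eval_expHom_of_mem_KK s hk, Fock.eval_smul, Fock.eval_smul, eval_one, eval_one]

/-- Pairing with `1` is evaluation at the origin, where the translation formula leaves `exp
(-‖Ξ(g)‖² / 2)`; the factor `2` in `inner_XiL2_self` cancels the half. -/
theorem spherical_function (s : ℝ) (g : GG) :
    inner ℂ (Fock.one (ℕ × ℕ)) (expHom (affineAction s g) (Fock.one (ℕ × ℕ))) =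
      ((Real.exp (-s ^ 2) ^
        {i : ℕ | (g.1 : Equiv.Perm ℕ) i ≠ (g.2 : Equiv.Perm ℕ) i}.ncard : ℝ) : ℂ) := by
  rw [inner_one, affineAction_apply, map_mul, LinearIsometryEquiv.coe_mul, Function.comp_apply,
    isExp_expHom.translation, isExp_expHom.orthogonal, eval_one, inner_XiL2_self,
    ← Real.exp_nat_mul, Complex.ofReal_exp]
  simp only [inner_zero_left]
  rw [one_mul]
  congr 1
  push_cast
  ring

/-! ### Cycles -/

/-- The cycle of a permutation through a point. -/
def cycleSet (π : Equiv.Perm ℕ) (i : ℕ) : Set ℕ := {j | π.SameCycle i j}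

theorem cycleSet_eq_iff (π : Equiv.Perm ℕ) (i j : ℕ) :
    cycleSet π i = cycleSet π j ↔ π.SameCycle i j := by
  constructor
  · intro h
    have : j ∈ cycleSet π j := Equiv.Perm.SameCycle.refl π j
    rwa [← h] at this
  · intro h
    ext l
    exact ⟨fun hl => h.symm.trans hl, fun hl => h.trans hl⟩

theorem cycleSet_of_fixed {π : Equiv.Perm ℕ} {i : ℕ} (hi : π i = i) : cycleSet π i = {i} := by
  ext j
  exact ⟨fun h => (Equiv.Perm.SameCycle.eq_of_left h hi).symm, fun h => h ▸
    Equiv.Perm.SameCycle.refl π _⟩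

theorem cycleSet_subset {π : Equiv.Perm ℕ} {i : ℕ} (hi : π i ≠ i) :
    cycleSet π i ⊆ {j | π j ≠ j} := fun _ hj h =>
  hi ((Equiv.Perm.SameCycle.apply_eq_self_iff hj).2 h)

theorem two_le_ncard_cycleSet {π : Equiv.Perm ℕ} (hπ : {i | π i ≠ i}.Finite) {i : ℕ}
    (hi : π i ≠ i) : 2 ≤ (cycleSet π i).ncard := by
  refine (Set.one_lt_ncard_iff (hπ.subset (cycleSet_subset hi))).2
    ⟨i, π i, Equiv.Perm.SameCycle.refl π i, ?_, hi.symm⟩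
  exact Equiv.Perm.sameCycle_apply_right.2 (Equiv.Perm.SameCycle.refl π i)

/-- The number of the points moved by a permutation is the sum of the lengths of its nontrivial
cycles, in multiplicative form. -/
theorem pow_ncard_support_eq_finprod {π : Equiv.Perm ℕ} (hπ : {i | π i ≠ i}.Finite) (a : ℝ) :
    a ^ {i | π i ≠ i}.ncard = ∏ᶠ (k : ℕ) (_ : 2 ≤ k), (a ^ k) ^ numCycles π k := by
  classical
  set s : Finset ℕ := hπ.toFinset with hs
  have hmem : ∀ i, i ∈ s ↔ π i ≠ i := fun i => by simp [hs]
  set O : Finset (Set ℕ) := s.image (cycleSet π) with hO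
  have hnum : ∀ k, 2 ≤ k → numCycles π k = (O.filter fun C => C.ncard = k).card := by
    intro k hk
    rw [numCycles, ← Set.ncard_coe_finset]
    congr 1
    ext C
    simp only [Set.mem_ofPred_eq, Finset.coe_filter, hO, Finset.mem_image, hmem]
    constructor
    · rintro ⟨⟨i, rfl⟩, hc⟩
      -- Fixed points form classes of one element, which `2 ≤ k` excludes.
      refine ⟨⟨i, fun hi => ?_, rfl⟩, hc⟩
      have h1 := cycleSet_of_fixed hi
      rw [cycleSet] at h1
      rw [h1, Set.ncard_singleton] at hc
      omega
    · rintro ⟨⟨i, -, rfl⟩, hc⟩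
      exact ⟨⟨i, rfl⟩, hc⟩
  have hO2 : ∀ C ∈ O, 2 ≤ C.ncard := by
    intro C hC
    obtain ⟨i, hi, rfl⟩ := Finset.mem_image.1 hC
    exact two_le_ncard_cycleSet hπ ((hmem i).1 hi)
  have hcard : s.card = ∑ C ∈ O, C.ncard := by
    rw [Finset.card_eq_sum_card_image (cycleSet π) s]
    refine Finset.sum_congr rfl fun C hC => ?_
    obtain ⟨i, hi, rfl⟩ := Finset.mem_image.1 hC
    rw [← Set.ncard_coe_finset]
    congr 1
    ext j
    simp only [Finset.coe_filter, Set.mem_ofPred_eq, cycleSet_eq_iff, hmem]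
    exact ⟨fun h => h.2.symm, fun h => ⟨cycleSet_subset ((hmem i).1 hi) h,
      Equiv.Perm.SameCycle.symm h⟩⟩
  -- The product over cycles is regrouped by length; lengths that do not occur contribute a zeroth
  -- power.
  rw [Set.ncard_eq_toFinset_card _ hπ, ← hs, hcard, ← Finset.prod_pow_eq_pow_sum,
    finprod_cond_eq_prod_of_cond_iff (t := O.image Set.ncard),
    ← Finset.prod_fiberwise_of_maps_to fun C hC => Finset.mem_image_of_mem Set.ncard hC]
  · refine Finset.prod_congr rfl fun k hk => ?_
    obtain ⟨C, hC, rfl⟩ := Finset.mem_image.1 hk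
    rw [hnum _ (hO2 C hC), ← Finset.prod_const]
    exact Finset.prod_congr rfl fun D hD => by rw [(Finset.mem_filter.1 hD).2]
  · intro k hk
    constructor
    · intro h2
      have h0 : (O.filter fun C => C.ncard = k).Nonempty := by
        rw [← Finset.card_ne_zero, ← hnum k h2]
        intro h0
        exact hk (by rw [h0, pow_zero])
      obtain ⟨C, hC⟩ := h0
      exact Finset.mem_image.2 ⟨C, Finset.mem_filter.1 hC⟩
    · intro h
      obtain ⟨C, hC, rfl⟩ := Finset.mem_image.1 h
      exact hO2 C hC

/-- The map `τ` carries the points where `σ` and `τ` differ onto the points moved by `σ τ⁻¹`, so the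
cycle count applies to the latter. -/
theorem pow_ncard_eq_thoma (a : ℝ) (g : GG) :
    a ^ {i : ℕ | (g.1 : Equiv.Perm ℕ) i ≠ (g.2 : Equiv.Perm ℕ) i}.ncard =
      thoma (fun _ : Unit => a) (fun j : Empty => j.elim) g := by
  set π : Equiv.Perm ℕ := (g.1 : Equiv.Perm ℕ) * (g.2 : Equiv.Perm ℕ)⁻¹ with hπ
  have hfin : {i | π i ≠ i}.Finite := (g.1 * g.2⁻¹).2
  have himg : {i | π i ≠ i} = (g.2 : Equiv.Perm ℕ) ''
      {i : ℕ | (g.1 : Equiv.Perm ℕ) i ≠ (g.2 : Equiv.Perm ℕ) i} := by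
    ext i
    obtain ⟨j, rfl⟩ := (g.2 : Equiv.Perm ℕ).surjective i
    rw [(g.2 : Equiv.Perm ℕ).injective.mem_set_image]
    simp [hπ]
  rw [← Set.ncard_image_of_injective _ (g.2 : Equiv.Perm ℕ).injective, ← himg,
    pow_ncard_support_eq_finprod hfin, thoma]
  simp [hπ]

/-! ### Irreducibility -/

/-- A cyclic unitary representation is irreducible if the vectors fixed by a subgroup are exactly
the multiples of the cyclic vector. -/
theorem eq_bot_or_eq_of_fixed_iff {G F : Type*} [Group G] [NormedAddCommGroup F]
    [InnerProductSpace ℂ F] [CompleteSpace F] (ρ : G →* (F ≃ₗᵢ[ℂ] F)) (K : Subgroup G) (v : F)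
    (hv : ∀ f : F, (∀ k ∈ K, ρ k f = f) ↔ ∃ c : ℂ, f = c • v) (W : Submodule ℂ F)
    (hW : IsClosed (W : Set F))
    (hle : W ≤ (Submodule.span ℂ (Set.range fun g => ρ g v)).topologicalClosure)
    (hinv : ∀ g, ∀ f ∈ W, ρ g f ∈ W) :
    W = ⊥ ∨ W = (Submodule.span ℂ (Set.range fun g => ρ g v)).topologicalClosure := by
  have : CompleteSpace W := hW.completeSpace_coe
  have hinvol (g : G) (f : F) : ρ g (ρ g⁻¹ f) = f := by
    rw [← Function.comp_apply (f := ρ g), ← LinearIsometryEquiv.coe_mul, ← map_mul,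
      mul_inv_cancel, map_one]
    rfl
  -- Elements of `K` fix `v` and preserve `W`, hence commute with taking the projection of `v`.
  have hfix : ∀ k ∈ K, ρ k (W.starProjection v) = W.starProjection v := by
    intro k hk
    have hvk : ρ k v = v := (hv v).2 ⟨1, (one_smul _ _).symm⟩ k hk
    refine (Submodule.eq_starProjection_of_mem_of_inner_eq_zero
      (hinv k _ (Submodule.starProjection_apply_mem _ _)) fun w hw => ?_).symm
    rw [← hinvol k w]
    nth_rw 1 [← hvk]
    rw [← map_sub, LinearIsometryEquiv.inner_map_map]
    exact Submodule.starProjection_inner_eq_zero _ _ (hinv _ _ hw)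
  obtain ⟨c, hc⟩ := (hv _).1 hfix
  -- If the projection vanishes, the whole orbit of `v` is orthogonal to `W`, and `W`, lying in its
  -- closed span, is orthogonal to itself. Otherwise `v` lies in `W`.
  by_cases hc0 : c = 0
  · left
    rw [hc0, zero_smul] at hc
    have hvW : v ∈ Wᗮ := (Submodule.starProjection_apply_eq_zero_iff _).1 hc
    have hle' : (Submodule.span ℂ (Set.range fun g => ρ g v)).topologicalClosure ≤ Wᗮ := by
      refine Submodule.topologicalClosure_minimal _ (Submodule.span_le.2 ?_)
        (Submodule.isClosed_orthogonal W)
      rintro _ ⟨g, rfl⟩ w hw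
      rw [← hinvol g w, LinearIsometryEquiv.inner_map_map]
      exact hvW _ (hinv _ _ hw)
    exact Submodule.isOrtho_self.1 (hle.trans hle')
  · right
    have hvW : v ∈ W := by
      have h := W.smul_mem c⁻¹ (hc ▸ Submodule.starProjection_apply_mem W v)
      rwa [smul_smul, inv_mul_cancel₀ hc0, one_smul] at h
    refine le_antisymm hle (Submodule.topologicalClosure_minimal _ (Submodule.span_le.2 ?_) hW)
    rintro _ ⟨g, rfl⟩
    exact hinv g v hvW

end

end

end ThomaFock

open ThomaFock in
theorem mainTheorem1 (s : ℝ) (hs : 0 < s) :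
    -- `η` is not in `ℓ₂ ⊗ ℓ₂`, but `Ξ` is a cocycle with values in `ℓ₂ ⊗ ℓ₂` that vanishes on `K`
    ¬ Memℓp (eta s) 2 ∧
    (∀ g : GG, Memℓp (Xi s g) 2) ∧
    (∀ g₁ g₂ : GG, Xi s (g₁ * g₂) = UU g₁ (Xi s g₂) + Xi s g₁) ∧
    (∀ k ∈ KK, Xi s k = 0) ∧
    -- elements of the Fock space are functions, with continuous point evaluations
    (∀ x y : L2 (ℕ × ℕ), Continuous (fun f : Fock (ℕ × ℕ) => Fock.eval f x y) ∧
      ∀ p : PreFock (ℕ × ℕ), Fock.eval (p : Fock (ℕ × ℕ)) x y = p.1 (cpoint x y)) ∧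
    (∀ f f' : Fock (ℕ × ℕ), (∀ x y, Fock.eval f x y = Fock.eval f' x y) → f = f') ∧
    -- the affine isometric action of `G`, and the representation `Exp` of all affine isometries
    ∃ V : GG →* (L2 (ℕ × ℕ) ≃ᵃⁱ[ℝ] L2 (ℕ × ℕ)),
      (∀ (g : GG) (h : L2 (ℕ × ℕ)), (V g h : ℕ × ℕ → ℝ) = UU g h + Xi s g) ∧
    ∃ E : (L2 (ℕ × ℕ) ≃ᵃⁱ[ℝ] L2 (ℕ × ℕ)) →* (Fock (ℕ × ℕ) ≃ₗᵢ[ℂ] Fock (ℕ × ℕ)),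
      IsExp E ∧ (∀ E', IsExp E' → E' = E) ∧
      -- `1` is a unit vector and it is the unique `K`-fixed vector, up to scalars
      ‖Fock.one (ℕ × ℕ)‖ = 1 ∧
      (∀ f : Fock (ℕ × ℕ), (∀ k ∈ KK, E (V k) f = f) ↔ ∃ c : ℂ, f = c • Fock.one (ℕ × ℕ)) ∧
      -- the spherical function
      (∀ g : GG, inner ℂ (Fock.one (ℕ × ℕ)) (E (V g) (Fock.one (ℕ × ℕ))) =
        ((Real.exp (-s ^ 2) ^
          {i : ℕ | (g.1 : Equiv.Perm ℕ) i ≠ (g.2 : Equiv.Perm ℕ) i}.ncard : ℝ) : ℂ)) ∧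
      -- it is Thoma's function for one parameter `α` and empty `β`
      (∀ g : GG, Real.exp (-s ^ 2) ^
          {i : ℕ | (g.1 : Equiv.Perm ℕ) i ≠ (g.2 : Equiv.Perm ℕ) i}.ncard =
        thoma (fun _ : Unit => Real.exp (-s ^ 2)) (fun j : Empty => j.elim) g) ∧
      -- the subrepresentation generated by `1` is irreducible
      (∀ W : Submodule ℂ (Fock (ℕ × ℕ)), IsClosed (W : Set (Fock (ℕ × ℕ))) →
        W ≤ (Submodule.span ℂ
          (Set.range fun g : GG => E (V g) (Fock.one (ℕ × ℕ)))).topologicalClosure →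
        (∀ (g : GG), ∀ f ∈ W, E (V g) f ∈ W) →
        W = ⊥ ∨ W = (Submodule.span ℂ
          (Set.range fun g : GG => E (V g) (Fock.one (ℕ × ℕ)))).topologicalClosure) := by
  refine ⟨not_memℓp_eta hs.ne', fun g => memℓp_Xi g s, Xi_mul s, fun k hk => Xi_of_mem_KK s hk,
    fun x y => ⟨Fock.continuous_eval x y, fun p => Fock.eval_coe p x y⟩,
    fun f f' => Fock.ext_eval, affineAction s, coe_affineAction s, expHom, isExp_expHom,
    fun E' hE' => hE'.eq isExp_expHom, norm_one_fock, fixed_iff s, spherical_function s,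
    pow_ncard_eq_thoma _, fun W hW hle hinv => ?_⟩
  exact eq_bot_or_eq_of_fixed_iff (expHom.comp (affineAction s)) KK (Fock.one (ℕ × ℕ))
    (fixed_iff s) W hW hle hinv
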